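/- Let $G=(V,E)$, $V=\{v_1,\dots,v_n\}$, be an ordered DAG: every edge $(v_i,v_j)$ has $i<j$, and the sinks are the last vertices. Let $m=|E|$, let $\hat n$ be the number of vertices that are not sinks, let $D_i$ be the list of out-neighbours of $v_i$ and $d_i=|D_i|$. Let $\Sigma$ be a linearly ordered set (for example $\mathbb R$ or $\{0,\dots,Z\}$), and let $f:V\to\Sigma$ be such that $f(v_i)=h_i(f(u_1),\dots,f(u_{d_i}))$ for $i\le\hat n$, where $(u_1,\dots,u_{d_i})=D_i$ and $h_i\in\{\mathrm{MAX},\mathrm{MIN}\}$ may depend on $i$, while at a sink $f(v_i)$ is a fixed known function of one input word attached to $v_i$. The lists $D_i$ and the words are the input and are accessed by quantum queries; $n$, the $d_i$, the $h_i$, an index $a$, and the length $q\ge 2$ of a longest directed path starting at $v_a$ (the path to the vertex farthest from $v_a$) are known. Running time means number of queries. Then there is a quantum algorithm that outputs $f(v_a)$ with error probability $O(1/q)$ in expected running time $O(\sqrt{\hat n m}\,\log q)=O(\sqrt{nm}\,\log n)$, with absolute constants. If all the $h_i$ are $\mathrm{MAX}$, or all of them are $\mathrm{MIN}$, the algorithm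 can be taken to be the one-pass dynamic program: for $i=\hat n,\dots,1$ assign $t[i]\leftarrow Q_i(t_f(j_1),\dots,t_f(j_{d_i}))$, where $(v_{j_1},\dots,v_{j_{d_i}})=D_i$, $t_f(j)=t[j]$ for $j\le\hat n$ and $t_f(j)=f(v_j)$ for $j>\hat n$, and $Q_i$ is a bounded-error quantum algorithm for $h_i$; then return $t[a]$. -/

import Mathlib

/-! ### Quantum query algorithms

The input is a function `x : ι → α` (`ι` indexes the positions, `α` is the finite alphabet,
a finite abelian group).  The basis states are triples `|i⟩|z⟩|w⟩` of a position, a content of the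
answer register and a content of the work space. -/

/-- Computational basis `|i⟩|z⟩|w⟩` with a work space of `s` basis states. -/
abbrev QBasis (ι α : Type) (s : ℕ) : Type := ι × α × Fin s

/-- The query unitary `|i⟩|z⟩|w⟩ ↦ |i⟩|z + x i⟩|w⟩`, acting on amplitude vectors. -/
def queryOp {ι α : Type} [AddCommGroup α] {s : ℕ} (x : ι → α) (ψ : QBasis ι α s → ℂ) :
    QBasis ι α s → ℂ :=
  fun b => ψ (b.1, b.2.1 - x b.1, b.2.2)

/-- A quantum query circuit: it starts in a basis state, alternates input-independent unitaries
`U 0, …, U queries` with `queries` applications of the query unitary, and ends with a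
measurement in the computational basis. -/
structure QCircuit (ι α : Type) [Fintype ι] [Fintype α] [DecidableEq ι] [DecidableEq α] where
  /-- size of the work space -/
  work : ℕ
  /-- initial basis state -/
  init : QBasis ι α work
  /-- number of queries -/
  queries : ℕ
  /-- the input-independent unitaries (only `U 0, …, U queries` are used) -/
  U : ℕ → Matrix.unitaryGroup (QBasis ι α work) ℂ

namespace QCircuit

variable {ι α : Type} [Fintype ι] [Fintype α] [DecidableEq ι] [DecidableEq α] [AddCommGroup α]

/-- The state after `t` queries (and the unitary following the last of them). -/
def state (c : QCircuit ι α) (x : ι → α) : ℕ → QBasis ι α c.work → ℂ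
  | 0 => (c.U 0 : Matrix (QBasis ι α c.work) (QBasis ι α c.work) ℂ).mulVec (Pi.single c.init 1)
  | t + 1 => (c.U (t + 1) : Matrix (QBasis ι α c.work) (QBasis ι α c.work) ℂ).mulVec
      (queryOp x (c.state x t))

/-- Probability that the final measurement yields the basis state `b` (Born rule). -/
noncomputable def prob (c : QCircuit ι α) (x : ι → α) (b : QBasis ι α c.work) : ℝ :=
  ‖c.state x c.queries b‖ ^ 2

end QCircuit

/-- A quantum algorithm with classical control: a classical program that repeatedly runs a
quantum query circuit, chosen according to the measurement outcomes seen so far, and finally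
returns an element of `ω`. -/
inductive QAlg (ι α : Type) [Fintype ι] [Fintype α] [DecidableEq ι] [DecidableEq α] (ω : Type) :
    Type where
  | ret (o : ω) : QAlg ι α ω
  | run (c : QCircuit ι α) (next : QBasis ι α c.work → QAlg ι α ω) : QAlg ι α ω

namespace QAlg

variable {ι α : Type} [Fintype ι] [Fintype α] [DecidableEq ι] [DecidableEq α]

/-- Sequential composition. -/
def bind {ω ω' : Type} (A : QAlg ι α ω) (B : ω → QAlg ι α ω') : QAlg ι α ω' :=
  match A with
  | .ret o => B o
  | .run c next => .run c (fun b => (next b).bind B)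

variable [AddCommGroup α]

open Classical in
/-- Probability that the algorithm returns `o` on input `x`. -/
noncomputable def prob {ω : Type} (A : QAlg ι α ω) (x : ι → α) (o : ω) : ℝ :=
  match A with
  | .ret o' => if o' = o then 1 else 0
  | .run c next => ∑ b, c.prob x b * (next b).prob x o

/-- Expected running time on input `x`: the expected total number of queries. -/
noncomputable def expectedTime {ω : Type} (A : QAlg ι α ω) (x : ι → α) : ℝ :=
  match A with
  | .ret _ => 0
  | .run c next => c.queries + ∑ b, c.prob x b * (next b).expectedTime x

end QAlg

/-! ### Ordered DAGs in the adjacency list model -/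

/-- Adjacency lists of a directed graph on `Fin n` with out-degrees `d`: `D i k` is the `k`-th
out-neighbour of `i`. -/
abbrev AdjLists {n : ℕ} (d : Fin n → ℕ) : Type := (i : Fin n) → Fin (d i) → Fin n

/-- `n̂`, the number of vertices that are not sinks. -/
def numNonSinks {n : ℕ} (d : Fin n → ℕ) : ℕ := (Finset.univ.filter fun i => d i ≠ 0).card

/-- `m`, the number of edges. -/
def numEdges {n : ℕ} (d : Fin n → ℕ) : ℕ := ∑ i, d i

/-- The lists describe an ordered DAG: no repeated edges, edges go from smaller to larger
indices, and only the first `n̂` vertices have outgoing edges. -/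
structure IsOrderedDAG {n : ℕ} {d : Fin n → ℕ} (D : AdjLists d) : Prop where
  simple : ∀ i, Function.Injective (D i)
  sorted : ∀ i k, i < D i k
  sinks_last : ∀ i : Fin n, numNonSinks d ≤ (i : ℕ) → d i = 0

/-- There is an edge from `i` to `j`. -/
def IsEdge {n : ℕ} {d : Fin n → ℕ} (D : AdjLists d) (i j : Fin n) : Prop := ∃ k, D i k = j

/-- There is a path with `l` edges that starts at `a`. -/
def HasPathFrom {n : ℕ} {d : Fin n → ℕ} (D : AdjLists d) (a : Fin n) (l : ℕ) : Prop :=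
  ∃ p : ℕ → Fin n, p 0 = a ∧ ∀ j < l, IsEdge D (p j) (p (j + 1))

/-- `q` is the length of the (longest) path from `a` to the vertex farthest from it. -/
def IsDepth {n : ℕ} {d : Fin n → ℕ} (D : AdjLists d) (a : Fin n) (q : ℕ) : Prop :=
  IsGreatest {l | HasPathFrom D a l} q

/-! ### The dynamic programming problem -/

/-- The two transition functions. -/
inductive Transition where
  | max
  | min

/-- `v` is the value of the transition function at the arguments `u`. -/
def Transition.IsValue {Val : Type} [LinearOrder Val] {k : ℕ} (h : Transition) (u : Fin k → Val)
    (v : Val) : Prop :=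
  match h with
  | .max => IsGreatest (Set.range u) v
  | .min => IsLeast (Set.range u) v

/-- `f` is the function computed by the dynamic program with transitions `h`.  Each vertex `j`
carries an input word `y j`, and the value at a sink `j` is `val j (y j)`, a fixed function of
its word. -/
structure IsDPFunction {n K : ℕ} {Val : Type} [LinearOrder Val] {d : Fin n → ℕ}
    (h : Fin n → Transition) (val : Fin n → Fin K → Val) (D : AdjLists d) (y : Fin n → Fin K)
    (f : Fin n → Val) : Prop where
  inner : ∀ i, d i ≠ 0 → (h i).IsValue (fun k => f (D i k)) (f i)
  sink : ∀ i, d i = 0 → f i = val i (y i)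

/-- Positions of the input: the entries of the adjacency lists and the words of the vertices. -/
abbrev Position {n : ℕ} (d : Fin n → ℕ) : Type := ((i : Fin n) × Fin (d i)) ⊕ Fin n

/-- The input as a string: a list entry is answered by the neighbour, a word position by the
word; the other component of the answer is zero. -/
def inputString {n K : ℕ} [NeZero n] [NeZero K] {d : Fin n → ℕ} (D : AdjLists d)
    (y : Fin n → Fin K) : Position d → Fin n × Fin K
  | .inl e => (D e.1 e.2, 0)
  | .inr j => (0, y j)

/-- The type of quantum algorithms for the problem. -/
abbrev DAGAlg {n : ℕ} (d : Fin n → ℕ) (K : ℕ) (Val : Type) : Type :=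
  QAlg (Position d) (Fin n × Fin K) Val

/-! ### The one-pass quantum dynamic program -/

/-- The arguments `t_f(j₁), …, t_f(j_{dᵢ})` seen at vertex `i`, where `j₁, …` is the adjacency
list of `i`, and `t_f(j)` is the table entry `t j` if `j` is not a sink and the value of `j` if
it is a sink. -/
def arguments {n K : ℕ} {Val : Type} {d : Fin n → ℕ} (val : Fin n → Fin K → Val)
    (t : Fin n → Val) (D : AdjLists d) (y : Fin n → Fin K) (i : Fin n) : Fin (d i) → Val :=
  fun k => if d (D i k) = 0 then val (D i k) (y (D i k)) else t (D i k)

/-- `Q` is a bounded-error quantum algorithm for the transition function `h` at vertex `i` (given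
the table `t` as classical data): its output distribution and its expected time are determined
by the arguments, and it returns the value of `h` with probability at least `2/3`. -/
def IsVertexRoutine {n K : ℕ} [NeZero n] [NeZero K] {Val : Type} [LinearOrder Val]
    {d : Fin n → ℕ} (h : Transition) (val : Fin n → Fin K → Val) (i : Fin n)
    (Q : (Fin n → Val) → DAGAlg d K Val) : Prop :=
  (∀ (t t' : Fin n → Val) (D D' : AdjLists d) (y y' : Fin n → Fin K),
    arguments val t D y i = arguments val t' D' y' i →
      (∀ v, (Q t).prob (inputString D y) v = (Q t').prob (inputString D' y') v) ∧
      (Q t).expectedTime (inputString D y) = (Q t').expectedTime (inputString D' y')) ∧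
  ∀ (t : Fin n → Val) (D : AdjLists d) (y : Fin n → Fin K) (v : Val),
    h.IsValue (arguments val t D y i) v → 2 / 3 ≤ (Q t).prob (inputString D y) v

/-- For each vertex `i` of the list, in this order: `t[i] ← Qᵢ`. -/
def sweep {ι α : Type} [Fintype ι] [Fintype α] [DecidableEq ι] [DecidableEq α] {n : ℕ} {Val : Type}
    (Q : Fin n → (Fin n → Val) → QAlg ι α Val) :
    List (Fin n) → (Fin n → Val) → QAlg ι α (Fin n → Val)
  | [], t => .ret t
  | i :: l, t => (Q i t).bind fun v => sweep Q l (Function.update t i v)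

/-- The algorithm is the one-pass dynamic program: for `i = n̂, …, 1` it assigns
`t[i] ← Qᵢ(t_f(j₁), …, t_f(j_{dᵢ}))`, with bounded-error quantum algorithms `Qᵢ` for the
transition functions, and then it returns `t[a]`; `t₀` is the initial content of the table. -/
def IsDynamicProgram {n K : ℕ} [NeZero n] [NeZero K] {Val : Type} [LinearOrder Val]
    {d : Fin n → ℕ} (h : Fin n → Transition) (val : Fin n → Fin K → Val) (a : Fin n)
    (A : DAGAlg d K Val) : Prop :=
  ∃ (Q : Fin n → (Fin n → Val) → DAGAlg d K Val) (t₀ : Fin n → Val),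
    (∀ i, d i ≠ 0 → IsVertexRoutine (h i) val i (Q i)) ∧
    A = (sweep Q ((List.finRange n).filter fun i => d i ≠ 0).reverse t₀).bind fun t => .ret (t a)

/-! Iterated Grover search finds the optimum of `N` values with error at most `10 ^ (-k)` in
expected time `O(k √N)`, and it always returns one of the values (`Probe.probOf_optimize_le`,
`Probe.expectedTime_optimize_le`, `Probe.surely_optimize`). At vertex `i` this costs `O(k √(d i))`;
by Cauchy–Schwarz the square roots sum to at most `√(n̂ m)`.

If all transitions agree, errors are one-sided: every stored entry is the value of some argument, so
by induction no entry is ever better than the true value. Only the vertices of one optimal path from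
`a` then have to be computed correctly, and there are at most `q` of them. With `k = ⌈log q⌉` each
fails with probability at most `1 / q ^ 2`, and a union bound gives error `1 / q`
(`exists_optimal_path`, `probOf_sweep_le`).

With mixed transitions an error can push a later entry in either direction, so no single path
suffices, and amplifying at all `n̂` vertices would cost `log n̂` instead of `log q`. Instead the
list of non-sinks is halved recursively. After both halves of a block are processed, one Grover
search over all edges of the block looks for an argument that beats its table entry. Entries are
always values of arguments, so such an edge exists exactly when some entry is wrong; when one is
found, the block is recomputed. A block of at most `2 ^ k` vertices fails with probability at most
`1 / (100 * 2 ^ k)`. Relative to the budget `√(2 ^ k m)` the verification and rerun costs decay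
geometrically in `k`, so the total is `O(√(n̂ m))` without a logarithm (`sweepSpec_verifiedSweep`).
The error is `O(1 / n̂)`, hence `O(1 / q)`, because a path has at most `n̂` edges. -/

/-! ### Norm preservation: measurement probabilities sum to one. -/

theorem sum_norm_sq_mulVec {B : Type*} [Fintype B] [DecidableEq B]
    (U : Matrix.unitaryGroup B ℂ) (ψ : B → ℂ) :
    ∑ b, ‖(U : Matrix B B ℂ).mulVec ψ b‖ ^ 2 = ∑ b, ‖ψ b‖ ^ 2 := by
  have key : ∀ φ : B → ℂ, ((∑ b, ‖φ b‖ ^ 2 : ℝ) : ℂ) = dotProduct (star φ) φ := by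
    intro φ
    simp only [dotProduct, Pi.star_apply, Complex.ofReal_sum]
    refine Finset.sum_congr rfl fun b _ => ?_
    rw [RCLike.star_def, Complex.conj_mul', Complex.ofReal_pow]
  have hU : star (U : Matrix B B ℂ) * U = 1 := Unitary.coe_star_mul_self U
  rw [← Complex.ofReal_inj, key, key, Matrix.star_mulVec, Matrix.dotProduct_mulVec,
    Matrix.vecMul_vecMul, ← Matrix.star_eq_conjTranspose, hU, Matrix.vecMul_one]

theorem sum_norm_sq_queryOp {ι α : Type} [Fintype ι] [Fintype α] [AddCommGroup α] {s : ℕ}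
    (x : ι → α) (ψ : QBasis ι α s → ℂ) :
    ∑ b, ‖queryOp x ψ b‖ ^ 2 = ∑ b, ‖ψ b‖ ^ 2 := by
  simp only [Fintype.sum_prod_type, queryOp]
  refine Finset.sum_congr rfl fun i _ => ?_
  exact Fintype.sum_equiv (Equiv.subRight (x i)) _ _ fun z => rfl

namespace QCircuit

variable {ι α : Type} [Fintype ι] [Fintype α] [DecidableEq ι] [DecidableEq α] [AddCommGroup α]

theorem prob_nonneg (c : QCircuit ι α) (x : ι → α) (b : QBasis ι α c.work) : 0 ≤ c.prob x b := by
  unfold prob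
  positivity

theorem sum_norm_sq_state (c : QCircuit ι α) (x : ι → α) (t : ℕ) :
    ∑ b, ‖c.state x t b‖ ^ 2 = 1 := by
  induction t with
  | zero =>
    rw [state, sum_norm_sq_mulVec, Finset.sum_eq_single c.init]
    · simp
    · intro b _ hb
      simp [hb]
    · simp
  | succ t ih => rw [state, sum_norm_sq_mulVec, sum_norm_sq_queryOp, ih]

theorem sum_prob (c : QCircuit ι α) (x : ι → α) : ∑ b, c.prob x b = 1 :=
  c.sum_norm_sq_state x c.queries

end QCircuit

/-! ### Expectations, sure events and error bounds for composed algorithms. -/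

namespace QAlg

variable {ι α : Type} [Fintype ι] [Fintype α] [DecidableEq ι] [DecidableEq α]
variable {ω ω' : Type}

@[simp] theorem bind_ret_left (o : ω) (B : ω → QAlg ι α ω') : (ret o).bind B = B o := rfl

variable [AddCommGroup α]

/-- Expectation of `F` at the outcome of the algorithm on input `x`. -/
noncomputable def expect (A : QAlg ι α ω) (x : ι → α) (F : ω → ℝ) : ℝ :=
  match A with
  | .ret o => F o
  | .run c next => ∑ b, c.prob x b * (next b).expect x F

/-- Every outcome that is reached with nonzero probability on input `x` satisfies `P`. -/
def Surely (A : QAlg ι α ω) (x : ι → α) (P : ω → Prop) : Prop :=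
  match A with
  | .ret o => P o
  | .run c next => ∀ b, c.prob x b ≠ 0 → (next b).Surely x P

@[simp] theorem expect_ret (o : ω) (x : ι → α) (F : ω → ℝ) :
    (ret o : QAlg ι α ω).expect x F = F o := rfl

@[simp] theorem surely_ret (o : ω) (x : ι → α) (P : ω → Prop) :
    (ret o : QAlg ι α ω).Surely x P ↔ P o := Iff.rfl

@[simp] theorem expectedTime_ret (o : ω) (x : ι → α) :
    (ret o : QAlg ι α ω).expectedTime x = 0 := rfl

open Classical in
theorem prob_eq_expect (A : QAlg ι α ω) (x : ι → α) (o : ω) :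
    A.prob x o = A.expect x fun o' => if o' = o then 1 else 0 := by
  induction A with
  | ret o' => simp [prob]
  | run c next ih => simp only [prob, expect, ih]

theorem expect_bind (A : QAlg ι α ω) (B : ω → QAlg ι α ω') (x : ι → α) (F : ω' → ℝ) :
    (A.bind B).expect x F = A.expect x fun o => (B o).expect x F := by
  induction A with
  | ret o => rfl
  | run c next ih => simp only [bind, expect, ih]

theorem expect_const (A : QAlg ι α ω) (x : ι → α) (r : ℝ) : A.expect x (fun _ => r) = r := by
  induction A with
  | ret o => rfl
  | run c next ih => simp only [expect, ih, ← Finset.sum_mul, c.sum_prob, one_mul]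

theorem expect_add (A : QAlg ι α ω) (x : ι → α) (F G : ω → ℝ) :
    A.expect x (fun o => F o + G o) = A.expect x F + A.expect x G := by
  induction A with
  | ret o => rfl
  | run c next ih => simp only [expect, ih, mul_add, Finset.sum_add_distrib]

theorem expect_mul_const (A : QAlg ι α ω) (x : ι → α) (F : ω → ℝ) (r : ℝ) :
    A.expect x (fun o => F o * r) = A.expect x F * r := by
  induction A with
  | ret o => rfl
  | run c next ih => simp only [expect, ih, Finset.sum_mul, mul_assoc]

theorem expectedTime_bind (A : QAlg ι α ω) (B : ω → QAlg ι α ω') (x : ι → α) :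
    (A.bind B).expectedTime x = A.expectedTime x + A.expect x fun o => (B o).expectedTime x := by
  induction A with
  | ret o => simp [bind]
  | run c next ih =>
    simp only [bind, expectedTime, expect, ih, mul_add, Finset.sum_add_distrib]
    ring

theorem Surely.expect_le {A : QAlg ι α ω} {x : ι → α} {P : ω → Prop} (hA : A.Surely x P)
    {F G : ω → ℝ} (h : ∀ o, P o → F o ≤ G o) : A.expect x F ≤ A.expect x G := by
  induction A with
  | ret o => exact h o hA
  | run c next ih =>
    refine Finset.sum_le_sum fun b _ => ?_
    by_cases hb : c.prob x b = 0
    · simp [hb]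
    · exact mul_le_mul_of_nonneg_left (ih b (hA b hb)) (c.prob_nonneg x b)

theorem surely_true (A : QAlg ι α ω) (x : ι → α) : A.Surely x fun _ => True := by
  induction A with
  | ret o => trivial
  | run c next ih => exact fun b _ => ih b

theorem Surely.mono {A : QAlg ι α ω} {x : ι → α} {P P' : ω → Prop} (hA : A.Surely x P)
    (h : ∀ o, P o → P' o) : A.Surely x P' := by
  induction A with
  | ret o => exact h o hA
  | run c next ih => exact fun b hb => ih b (hA b hb)

theorem Surely.and {A : QAlg ι α ω} {x : ι → α} {P P' : ω → Prop} (hA : A.Surely x P)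
    (hA' : A.Surely x P') : A.Surely x fun o => P o ∧ P' o := by
  induction A with
  | ret o => exact ⟨hA, hA'⟩
  | run c next ih => exact fun b hb => ih b (hA b hb) (hA' b hb)

theorem Surely.bind {A : QAlg ι α ω} {x : ι → α} {P : ω → Prop} (hA : A.Surely x P)
    {B : ω → QAlg ι α ω'} {P' : ω' → Prop} (h : ∀ o, P o → (B o).Surely x P') :
    (A.bind B).Surely x P' := by
  induction A with
  | ret o => exact h o hA
  | run c next ih => exact fun b hb => ih b (hA b hb)

theorem expect_mono (A : QAlg ι α ω) (x : ι → α) {F G : ω → ℝ} (h : ∀ o, F o ≤ G o) :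
    A.expect x F ≤ A.expect x G :=
  (A.surely_true x).expect_le fun o _ => h o

theorem expect_nonneg (A : QAlg ι α ω) (x : ι → α) {F : ω → ℝ} (h : ∀ o, 0 ≤ F o) :
    0 ≤ A.expect x F :=
  (A.expect_const x 0).symm.le.trans (A.expect_mono x h)

theorem expectedTime_nonneg (A : QAlg ι α ω) (x : ι → α) : 0 ≤ A.expectedTime x := by
  induction A with
  | ret o => exact le_rfl
  | run c next ih =>
    exact add_nonneg (Nat.cast_nonneg _)
      (Finset.sum_nonneg fun b _ => mul_nonneg (c.prob_nonneg x b) (ih b))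

theorem expectedTime_bind_le (A : QAlg ι α ω) (B : ω → QAlg ι α ω') (x : ι → α) {T : ℝ}
    (h : ∀ o, (B o).expectedTime x ≤ T) : (A.bind B).expectedTime x ≤ A.expectedTime x + T := by
  rw [expectedTime_bind]
  gcongr
  exact (A.expect_mono x h).trans_eq (A.expect_const x T)

open Classical in
/-- Probability that the outcome of the algorithm on input `x` satisfies `P`. -/
noncomputable def probOf (A : QAlg ι α ω) (x : ι → α) (P : ω → Prop) : ℝ :=
  A.expect x fun o => if P o then 1 else 0

theorem probOf_nonneg (A : QAlg ι α ω) (x : ι → α) (P : ω → Prop) : 0 ≤ A.probOf x P := by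
  classical
  refine A.expect_nonneg x fun o => ?_
  split_ifs <;> norm_num

theorem probOf_le_one (A : QAlg ι α ω) (x : ι → α) (P : ω → Prop) : A.probOf x P ≤ 1 := by
  classical
  refine (A.expect_mono x (G := fun _ => 1) fun o => ?_).trans_eq (A.expect_const x 1)
  split_ifs <;> norm_num

theorem one_sub_prob (A : QAlg ι α ω) (x : ι → α) (o : ω) :
    1 - A.prob x o = A.probOf x fun o' => o' ≠ o := by
  classical
  have h := A.expect_add x (fun o' => if o' = o then 1 else 0)
    (fun o' => @ite _ (o' ≠ o) (Classical.propDecidable _) 1 0)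
  rw [(congrArg (A.expect x) (funext fun o' => by by_cases ho : o' = o <;> simp [ho])).trans
    (A.expect_const x 1)] at h
  rw [prob_eq_expect, probOf]
  linarith

theorem Surely.probOf_le {A : QAlg ι α ω} {x : ι → α} {P : ω → Prop} (hA : A.Surely x P)
    {Q Q' : ω → Prop} (h : ∀ o, P o → Q o → Q' o) : A.probOf x Q ≤ A.probOf x Q' := by
  classical
  refine hA.expect_le fun o ho => ?_
  have := h o ho
  split_ifs <;> simp_all

/-- Union bound: either the first stage fails (`Q`), or it succeeds and the second stage fails. The
sure property `P` may be used in the analysis of the second stage. -/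
theorem Surely.probOf_bind_le {A : QAlg ι α ω} {x : ι → α} {P : ω → Prop} (hA : A.Surely x P)
    {B : ω → QAlg ι α ω'} {Q : ω → Prop} {Q' : ω' → Prop} {ε : ℝ} (hε : 0 ≤ ε)
    (h : ∀ o, P o → ¬ Q o → (B o).probOf x Q' ≤ ε) :
    (A.bind B).probOf x Q' ≤ A.probOf x Q + ε := by
  classical
  unfold probOf at h ⊢
  rw [expect_bind, ← A.expect_const x ε, ← expect_add]
  refine hA.expect_le fun o ho => ?_
  by_cases hQ : Q o
  · have := (B o).probOf_le_one x Q'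
    unfold probOf at this
    simp only [hQ, if_true]
    linarith
  · simpa [hQ, A.expect_const] using h o ho hQ

/-- Amplification: if the second stage never spoils a good outcome of the first, both stages have to
fail and the error probabilities multiply. -/
theorem Surely.probOf_bind_le_mul {A : QAlg ι α ω} {x : ι → α} {P : ω → Prop} (hA : A.Surely x P)
    {B : ω → QAlg ι α ω'} {Q : ω → Prop} {Q' : ω' → Prop} {ε : ℝ}
    (h : ∀ o, P o → ¬ Q o → (B o).probOf x Q' ≤ 0) (h' : ∀ o, P o → Q o → (B o).probOf x Q' ≤ ε) :
    (A.bind B).probOf x Q' ≤ A.probOf x Q * ε := by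
  classical
  unfold probOf at h h' ⊢
  rw [expect_bind, ← expect_mul_const]
  refine hA.expect_le fun o ho => ?_
  by_cases hQ : Q o
  · simpa [hQ] using h' o ho hQ
  · simpa [hQ] using h o ho hQ

theorem surely_of_probOf_eq_zero {A : QAlg ι α ω} {x : ι → α} {P : ω → Prop}
    (h : A.probOf x (fun o => ¬ P o) = 0) : A.Surely x P := by
  induction A with
  | ret o =>
    by_contra ho
    simp [probOf, show ¬ P o from ho] at h
  | run c next ih =>
    intro b hb
    refine ih b ?_
    have h0 := (Finset.sum_eq_zero_iff_of_nonneg fun b _ => mul_nonneg (c.prob_nonneg x b)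
      ((next b).probOf_nonneg x fun o => ¬ P o)).1 h b (Finset.mem_univ b)
    exact (mul_eq_zero.1 h0).resolve_left hb

theorem Surely.probOf_eq_zero {A : QAlg ι α ω} {x : ι → α} {P Q : ω → Prop} (hA : A.Surely x P)
    (h : ∀ o, P o → ¬ Q o) : A.probOf x Q = 0 := by
  classical
  refine le_antisymm ?_ (A.probOf_nonneg x Q)
  refine (hA.expect_le (G := fun _ => 0) fun o ho => ?_).trans_eq (A.expect_const x 0)
  simp [h o ho]

end QAlg

/-! ### Superpositions over a family of basis states, monomial unitaries and reflections. -/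

/-- The vector with amplitude `a j` at the basis state `φ j`. -/
noncomputable def spread {J B : Type*} [Fintype J] [DecidableEq B] (φ : J → B) (a : J → ℂ) :
    B → ℂ :=
  ∑ j, Pi.single (φ j) (a j)

section spread

variable {J B : Type*} [Fintype J] [Fintype B] [DecidableEq B]

theorem mulVec_spread {φ φ' : J → B} {c : J → ℂ} {U : Matrix B B ℂ}
    (h : ∀ j, U.mulVec (Pi.single (φ j) 1) = Pi.single (φ' j) (c j)) (a : J → ℂ) :
    U.mulVec (spread φ a) = spread φ' fun j => c j * a j := by
  unfold spread
  rw [← Matrix.mulVecLin_apply, map_sum]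
  refine Finset.sum_congr rfl fun j _ => ?_
  have : Pi.single (φ j) (a j) = a j • (Pi.single (φ j) 1 : B → ℂ) := by
    rw [← Pi.single_smul, smul_eq_mul, mul_one]
  rw [this, map_smul, Matrix.mulVecLin_apply, h, ← Pi.single_smul, smul_eq_mul, mul_comm]

omit [Fintype B] in
theorem spread_apply {φ : J → B} (hφ : Function.Injective φ) (a : J → ℂ) (j : J) :
    spread φ a (φ j) = a j := by
  classical
  rw [spread, Finset.sum_apply, Finset.sum_eq_single j]
  · simp
  · intro k _ hk
    simp [hφ.ne hk.symm]
  · simp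

omit [Fintype B] in
theorem spread_apply_of_notMem {φ : J → B} (a : J → ℂ) {b : B} (hb : b ∉ Set.range φ) :
    spread φ a b = 0 := by
  rw [spread, Finset.sum_apply]
  refine Finset.sum_eq_zero fun j _ => ?_
  rw [Pi.single_eq_of_ne]
  rintro rfl
  exact hb ⟨j, rfl⟩

theorem dotProduct_spread {φ : J → B} (hφ : Function.Injective φ) (a c : J → ℂ) :
    dotProduct (spread φ c) (spread φ a) = ∑ j, c j * a j := by
  unfold dotProduct
  refine (Fintype.sum_of_injective φ hφ _ _ (fun b hb => ?_) fun j => ?_).symm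
  · rw [spread_apply_of_notMem a hb, mul_zero]
  · rw [spread_apply hφ, spread_apply hφ]

omit [Fintype B] in
theorem spread_single [DecidableEq J] (φ : J → B) (j : J) :
    spread φ (Pi.single j 1) = Pi.single (φ j) 1 := by
  rw [spread, Finset.sum_eq_single j]
  · simp
  · intro k _ hk
    simp [hk]
  · simp

/-- The unitary `|b⟩ ↦ c b |σ b⟩`. -/
noncomputable def monomial (σ : Equiv.Perm B) (c : B → ℂ) (hc : ∀ b, star (c b) * c b = 1) :
    Matrix.unitaryGroup B ℂ :=
  ⟨Matrix.of fun b b' => if b = σ b' then c b' else 0, by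
    rw [Matrix.mem_unitaryGroup_iff']
    ext i k
    rw [Matrix.mul_apply, Finset.sum_eq_single (σ i)]
    · by_cases h : i = k
      · subst h
        simpa [Matrix.star_apply] using hc i
      · simp [Matrix.star_apply, h]
    · intro b _ hb
      simp [Matrix.star_apply, hb]
    · simp⟩

theorem monomial_mulVec_single (σ : Equiv.Perm B) (c : B → ℂ) (hc : ∀ b, star (c b) * c b = 1)
    (b : B) : (monomial σ c hc : Matrix B B ℂ).mulVec (Pi.single b 1) = Pi.single (σ b) (c b) := by
  ext b'
  rw [Matrix.mulVec_single_one]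
  by_cases h : b' = σ b
  · subst h
    simp [monomial, Matrix.col]
  · simp [monomial, Matrix.col, h]

/-- The reflection about the direction of a real vector. -/
noncomputable def reflectionAbout (u : B → ℂ) (hu : star u = u) (h0 : dotProduct u u ≠ 0) :
    Matrix.unitaryGroup B ℂ :=
  ⟨(2 / dotProduct u u) • Matrix.vecMulVec u u - 1, by
    have hr : star (dotProduct u u) = dotProduct u u := by
      have := Matrix.star_dotProduct u u
      rw [hu] at this
      exact this.symm
    have hs : star ((2 / dotProduct u u) • Matrix.vecMulVec u u - 1 : Matrix B B ℂ) =
        (2 / dotProduct u u) • Matrix.vecMulVec u u - 1 := by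
      rw [star_sub, star_smul, star_one, Matrix.star_eq_conjTranspose,
        Matrix.conjTranspose_vecMulVec, hu, star_div₀, hr]
      simp
    rw [Matrix.mem_unitaryGroup_iff', hs]
    rw [sub_mul, mul_sub, one_mul, mul_one, smul_mul_smul_comm, Matrix.vecMulVec_mul_vecMulVec,
      Matrix.vecMulVec_smul, smul_smul]
    have : 2 / dotProduct u u * (2 / dotProduct u u) * dotProduct u u = 2 / dotProduct u u +
        2 / dotProduct u u := by
      field_simp
      norm_num
    rw [this, add_smul]
    abel⟩

theorem reflectionAbout_mulVec (u : B → ℂ) (hu : star u = u) (h0 : dotProduct u u ≠ 0)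
    (ψ : B → ℂ) : (reflectionAbout u hu h0 : Matrix B B ℂ).mulVec ψ =
      (2 * dotProduct u ψ / dotProduct u u) • u - ψ := by
  unfold reflectionAbout
  simp only
  rw [Matrix.sub_mulVec, Matrix.one_mulVec, Matrix.smul_mulVec, Matrix.vecMulVec_mulVec]
  congr 1
  ext b
  simp
  ring

/-- The reflection about the direction of the vector with real amplitudes `c j` at the basis
states `φ j`. -/
noncomputable def reflectAlong (φ : J → B) (hφ : Function.Injective φ) (c : J → ℝ)
    (hc : ∑ j, c j ^ 2 ≠ 0) : Matrix.unitaryGroup B ℂ :=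
  reflectionAbout (spread φ fun j => (c j : ℂ))
    (by
      ext b
      by_cases hb : b ∈ Set.range φ
      · obtain ⟨j, rfl⟩ := hb
        simp [spread_apply hφ]
      · simp [spread_apply_of_notMem _ hb])
    (by
      rw [dotProduct_spread hφ]
      simp only [← sq]
      exact_mod_cast hc)

theorem reflectAlong_mulVec_spread (φ : J → B) (hφ : Function.Injective φ) (c : J → ℝ)
    (hc : ∑ j, c j ^ 2 ≠ 0) (a : J → ℝ) :
    (reflectAlong φ hφ c hc : Matrix B B ℂ).mulVec (spread φ fun j => (a j : ℂ)) =
      spread φ fun j => ((2 * (∑ k, c k * a k) / ∑ k, c k ^ 2) * c j - a j : ℝ) := by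
  rw [reflectAlong, reflectionAbout_mulVec, dotProduct_spread hφ, dotProduct_spread hφ]
  ext b
  by_cases hb : b ∈ Set.range φ
  · obtain ⟨j, rfl⟩ := hb
    simp [spread_apply hφ, sq]
  · simp [spread_apply_of_notMem _ hb]

/-- A unitary that maps the basis state `φ j₀` to the uniform superposition of all `φ j`. -/
noncomputable def prepareUniform [DecidableEq J] (φ : J → B) (hφ : Function.Injective φ) (j₀ : J) :
    Matrix.unitaryGroup B ℂ :=
  reflectAlong φ hφ (fun j => 1 / √(Fintype.card J) + if j = j₀ then 1 else 0) (by
    have : 0 < ∑ j : J, (1 / √(Fintype.card J : ℝ) + if j = j₀ then 1 else 0) ^ 2 := by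
      refine Finset.sum_pos' (fun j _ => by positivity) ⟨j₀, Finset.mem_univ _, ?_⟩
      simp only [if_true]
      positivity
    exact this.ne')

/-- The uniform vector and the basis vector at `j₀` are unit vectors with real amplitudes, so the
reflection that fixes their sum exchanges them. -/
theorem prepareUniform_mulVec [DecidableEq J] (φ : J → B) (hφ : Function.Injective φ) (j₀ : J) :
    (prepareUniform φ hφ j₀ : Matrix B B ℂ).mulVec (Pi.single (φ j₀) 1) =
      spread φ fun _ => ((1 / √(Fintype.card J) : ℝ) : ℂ) := by
  have hN : (0 : ℝ) < Fintype.card J := by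
    have : Nonempty J := ⟨j₀⟩
    exact_mod_cast Fintype.card_pos
  have hs : √(Fintype.card J : ℝ) ^ 2 = Fintype.card J := Real.sq_sqrt hN.le
  have hs0 : 0 < √(Fintype.card J : ℝ) := Real.sqrt_pos.2 hN
  have h1 : Pi.single (φ j₀) 1 = spread φ fun j => (((if j = j₀ then 1 else 0 : ℝ)) : ℂ) := by
    rw [← spread_single]
    congr 1
    ext j
    by_cases h : j = j₀
    · subst h
      simp
    · simp [h]
  rw [h1, prepareUniform, reflectAlong_mulVec_spread]
  congr 1
  ext j
  congr 1
  have h2 : ∑ k : J, (1 / √(Fintype.card J : ℝ) + if k = j₀ then 1 else 0) ^ 2 =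
      2 + 2 / √(Fintype.card J : ℝ) := by
    have : ∀ k : J, (1 / √(Fintype.card J : ℝ) + if k = j₀ then 1 else 0) ^ 2 =
        1 / Fintype.card J + if k = j₀ then 1 + 2 / √(Fintype.card J : ℝ) else 0 := by
      intro k
      have hi : (1 / √(Fintype.card J : ℝ)) ^ 2 = 1 / Fintype.card J := by
        rw [div_pow, hs, one_pow]
      rw [← hi]
      split_ifs <;> ring
    simp only [this, Finset.sum_add_distrib, Finset.sum_ite_eq', Finset.mem_univ, if_true,
      Finset.sum_const, Finset.card_univ, nsmul_eq_mul]
    field_simp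
    ring
  have h3 : ∑ k : J, (1 / √(Fintype.card J : ℝ) + if k = j₀ then 1 else 0) *
      (if k = j₀ then 1 else 0) = 1 + 1 / √(Fintype.card J : ℝ) := by
    simp [add_comm]
  rw [h2, h3]
  have : 2 * (1 + 1 / √(Fintype.card J : ℝ)) / (2 + 2 / √(Fintype.card J : ℝ)) = 1 := by
    rw [div_eq_one_iff_eq (by positivity)]
    ring
  rw [this]
  ring

end spread

theorem queryOp_spread {ι α J : Type} [Fintype J] [AddCommGroup α] [DecidableEq ι] [DecidableEq α]
    {s : ℕ} (x : ι → α) (φ : J → QBasis ι α s) (a : J → ℂ) :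
    queryOp x (spread φ a) =
      spread (fun j => ((φ j).1, (φ j).2.1 + x (φ j).1, (φ j).2.2)) a := by
  ext ⟨i, z, w⟩
  simp only [queryOp, spread, Finset.sum_apply, Pi.single_apply]
  refine Finset.sum_congr rfl fun j _ => ?_
  refine if_congr ?_ rfl rfl
  simp only [Prod.ext_iff]
  constructor
  · rintro ⟨rfl, h2, h3⟩
    exact ⟨rfl, by rw [← h2]; simp, h3⟩
  · rintro ⟨rfl, h2, h3⟩
    exact ⟨rfl, by rw [h2]; simp, h3⟩

namespace QCircuit

variable {ι α J : Type} [Fintype ι] [Fintype α] [DecidableEq ι] [DecidableEq α] [AddCommGroup α]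
  [Fintype J] {s : ℕ}

theorem state_mk_zero (b : QBasis ι α s) (q : ℕ)
    (U : ℕ → Matrix.unitaryGroup (QBasis ι α s) ℂ) (x : ι → α) :
    (QCircuit.mk s b q U).state x 0 =
      (U 0 : Matrix (QBasis ι α s) (QBasis ι α s) ℂ).mulVec (Pi.single b 1) := rfl

theorem state_mk_succ (b : QBasis ι α s) (q : ℕ)
    (U : ℕ → Matrix.unitaryGroup (QBasis ι α s) ℂ) (x : ι → α) (t : ℕ) :
    (QCircuit.mk s b q U).state x (t + 1) =
      (U (t + 1) : Matrix (QBasis ι α s) (QBasis ι α s) ℂ).mulVec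
        (queryOp x ((QCircuit.mk s b q U).state x t)) := rfl

theorem prob_mk (b : QBasis ι α s) (q : ℕ) (U : ℕ → Matrix.unitaryGroup (QBasis ι α s) ℂ)
    (x : ι → α) (b' : QBasis ι α s) :
    (QCircuit.mk s b q U).prob x b' = ‖(QCircuit.mk s b q U).state x q b'‖ ^ 2 := rfl

theorem sum_prob_mul_of_state (b : QBasis ι α s) (q : ℕ)
    (U : ℕ → Matrix.unitaryGroup (QBasis ι α s) ℂ) (x : ι → α) {φ : J → QBasis ι α s}
    (hφ : Function.Injective φ) {a : J → ℝ}
    (h : (QCircuit.mk s b q U).state x q = spread φ fun j => (a j : ℂ))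
    (F : QBasis ι α s → ℝ) :
    ∑ b' : QBasis ι α s, (QCircuit.mk s b q U).prob x b' * F b' = ∑ j, a j ^ 2 * F (φ j) := by
  refine (Fintype.sum_of_injective φ hφ _ _ (fun b hb => ?_) fun j => ?_).symm
  · rw [prob_mk, h, spread_apply_of_notMem _ hb]
    simp
  · rw [prob_mk, h, spread_apply hφ]
    simp

end QCircuit

/-! ### The Grover circuit for functions evaluated with two adaptive queries. -/

/-- A function of an index `j` that is evaluated with two queries, the second of which depends on
the answer to the first. -/
structure Probe (J ι α V : Type) where
  /-- position of the first query -/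
  fst : J → ι
  /-- position of the second query -/
  snd : J → α → ι
  /-- value of the function, given the two answers -/
  out : J → α → α → V

namespace Probe

variable {J ι α V V' : Type}

/-- The function that the probe computes on input `x`. -/
def value (L : Probe J ι α V) (x : ι → α) (j : J) : V :=
  L.out j (x (L.fst j)) (x (L.snd j (x (L.fst j))))

/-- Postcomposition. -/
def map (L : Probe J ι α V) (F : V → V') : Probe J ι α V' where
  fst := L.fst
  snd := L.snd
  out j u z := F (L.out j u z)

variable [Fintype J] [Fintype ι] [Fintype α] [DecidableEq J] [DecidableEq ι] [DecidableEq α]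
  [AddCommGroup α]

/-- Work space content that stores an index and an answer. -/
noncomputable def store : J × α ≃ Fin (Fintype.card (J × α)) := Fintype.equivFin _

/-- Basis state `|fst j⟩|0⟩|j, 0⟩`. -/
noncomputable def home (L : Probe J ι α V) (j : J) : QBasis ι α (Fintype.card (J × α)) :=
  (L.fst j, 0, store (j, 0))

omit [Fintype ι] [DecidableEq J] [DecidableEq ι] [DecidableEq α] in
theorem home_injective (L : Probe J ι α V) : Function.Injective L.home := by
  intro j k h
  have := store.injective (congrArg (fun b => b.2.2) h)
  exact (Prod.ext_iff.1 this).1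

/-- Stores the answer register and moves from the first to the second query position. -/
noncomputable def fetch (L : Probe J ι α V) : Equiv.Perm (QBasis ι α (Fintype.card (J × α))) where
  toFun b := (Equiv.swap (L.fst (store.symm b.2.2).1) (L.snd (store.symm b.2.2).1 b.2.1) b.1,
    (store.symm b.2.2).2, store ((store.symm b.2.2).1, b.2.1))
  invFun b := (Equiv.swap (L.fst (store.symm b.2.2).1)
    (L.snd (store.symm b.2.2).1 (store.symm b.2.2).2) b.1,
    (store.symm b.2.2).2, store ((store.symm b.2.2).1, b.2.1))
  left_inv b := by simp
  right_inv b := by simp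

/-- Negation of the answer register. -/
def negate (s : ℕ) : Equiv.Perm (QBasis ι α s) where
  toFun b := (b.1, -b.2.1, b.2.2)
  invFun b := (b.1, -b.2.1, b.2.2)
  left_inv b := by simp
  right_inv b := by simp

open Classical in
/-- The unitaries of a Grover iteration: compute the value, flip the sign if it holds, uncompute,
and reflect about the uniform superposition. -/
noncomputable def iterationUnitary (L : Probe J ι α Prop) (j₀ : J) :
    ℕ → Matrix.unitaryGroup (QBasis ι α (Fintype.card (J × α))) ℂ
  | 0 => monomial L.fetch (fun _ => 1) (by simp)
  -- A query adds the answer in an arbitrary finite abelian group, so it is not its own inverse;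
  -- negating the register makes the next query to the same position erase it.
  | 1 => monomial (negate _) (fun b =>
      if L.out (store.symm b.2.2).1 (store.symm b.2.2).2 b.2.1 then -1 else 1)
      (by intro b; split_ifs <;> simp)
  | 2 => monomial (L.fetch.symm.trans (negate _)) (fun _ => 1) (by simp)
  | _ => reflectAlong L.home L.home_injective (fun _ => 1) (by
      have : Nonempty J := ⟨j₀⟩
      simp)

/-- The unitaries of Grover search. -/
noncomputable def groverUnitary (L : Probe J ι α Prop) (j₀ : J) :
    ℕ → Matrix.unitaryGroup (QBasis ι α (Fintype.card (J × α))) ℂ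
  | 0 => prepareUniform L.home L.home_injective j₀
  | t + 1 => L.iterationUnitary j₀ (t % 4)

end Probe

open Classical in
/-- Amplitude of the index `j` after `l` Grover iterations with marked set `S`. -/
noncomputable def groverAmp {J : Type} [Fintype J] (S : J → Prop) : ℕ → J → ℝ
  | 0, _ => 1 / √(Fintype.card J)
  | l + 1, j => 2 * (∑ k, (if S k then -1 else 1) * groverAmp S l k) / Fintype.card J -
      (if S j then -1 else 1) * groverAmp S l j

namespace Probe

variable {J ι α V : Type}
variable [Fintype J] [Fintype ι] [Fintype α] [DecidableEq J] [DecidableEq ι] [DecidableEq α]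
  [AddCommGroup α]

open Classical in
-- One iteration takes four queries: two compute the value and two uncompute it. Afterwards all
-- registers are back at `home`, so the state is described by real amplitudes over the indices
-- alone.
theorem grover_state_four_mul (L : Probe J ι α Prop) (j₀ : J) (x : ι → α) (q l : ℕ) :
    (QCircuit.mk (Fintype.card (J × α)) (L.home j₀) q (L.groverUnitary j₀)).state x (4 * l) =
      spread L.home fun j => (groverAmp (L.value x) l j : ℂ) := by
  induction l with
  | zero =>
    rw [mul_zero, QCircuit.state_mk_zero, groverUnitary, prepareUniform_mulVec]
    rfl
  | succ l ih =>
    have hs : ∀ t, L.groverUnitary j₀ (t + 1) = L.iterationUnitary j₀ (t % 4) := fun t => rfl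
    have e0 : (4 * l) % 4 = 0 := by lia
    have e1 : (4 * l + 1) % 4 = 1 := by lia
    have e2 : (4 * l + 2) % 4 = 2 := by lia
    have e3 : (4 * l + 3) % 4 = 3 := by lia
    rw [show 4 * (l + 1) = 4 * l + 3 + 1 by ring]
    simp only [QCircuit.state_mk_succ]
    rw [ih, hs, hs, hs, hs, e0, e1, e2, e3]
    -- The basis states are followed through the four queries; the amplitudes change only by the
    -- sign at the marked indices and in the final reflection.
    rw [queryOp_spread,
      mulVec_spread (φ' := fun j => (L.snd j (x (L.fst j)), 0, store (j, x (L.fst j))))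
        (c := fun _ => 1),
      queryOp_spread,
      mulVec_spread (φ' := fun j => (L.snd j (x (L.fst j)), -x (L.snd j (x (L.fst j))),
        store (j, x (L.fst j)))) (c := fun j => ((if L.value x j then -1 else 1 : ℝ) : ℂ)),
      queryOp_spread,
      mulVec_spread (φ' := fun j => (L.fst j, -x (L.fst j), store (j, 0))) (c := fun _ => 1),
      queryOp_spread]
    · have hh : (fun j : J => (L.fst j, -x (L.fst j) + x (L.fst j), store (j, (0 : α)))) =
          L.home := by
        funext j
        simp [home]
      simp only [hh, one_mul, ← Complex.ofReal_mul]
      rw [iterationUnitary, reflectAlong_mulVec_spread]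
      · congr 1
        ext j
        simp [groverAmp]
      all_goals simp
    · intro j
      rw [iterationUnitary, monomial_mulVec_single]
      congr 1
      simp [fetch, negate]
    · intro j
      rw [iterationUnitary, monomial_mulVec_single]
      simp only [negate, Equiv.coe_fn_mk, Equiv.symm_apply_apply, zero_add]
      congr 1
      by_cases h : L.value x j
      · exact (if_pos h).trans (by simp [h])
      · exact (if_neg h).trans (by simp [h])
    · intro j
      rw [iterationUnitary, monomial_mulVec_single]
      congr 1
      simp [fetch, home]

/-- Grover search with `l` iterations for an index at which the value holds. -/
noncomputable def grover (L : Probe J ι α Prop) (j₀ : J) (l : ℕ) : QAlg ι α J :=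
  .run ⟨Fintype.card (J × α), L.home j₀, 4 * l, L.groverUnitary j₀⟩
    fun b => .ret (store.symm b.2.2).1

theorem expect_grover (L : Probe J ι α Prop) (j₀ : J) (x : ι → α) (l : ℕ) (F : J → ℝ) :
    (L.grover j₀ l).expect x F = ∑ j, groverAmp (L.value x) l j ^ 2 * F j := by
  have h := QCircuit.sum_prob_mul_of_state (L.home j₀) (4 * l) (L.groverUnitary j₀) x
    L.home_injective (L.grover_state_four_mul j₀ x (4 * l) l) fun b => F (store.symm b.2.2).1
  refine Eq.trans ?_ (h.trans (by simp [home]))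
  rfl

theorem expectedTime_grover (L : Probe J ι α Prop) (j₀ : J) (x : ι → α) (l : ℕ) :
    (L.grover j₀ l).expectedTime x = 4 * l := by
  simp [grover, QAlg.expectedTime]

end Probe

/-! ### Closed form of the amplitudes and success probability of Grover search. -/

section trig

variable {J : Type} [Fintype J]

open Classical in
-- The state stays in the plane spanned by the uniform superpositions over marked and unmarked
-- indices, where each iteration is a rotation by `2 * θ`. The cosine may vanish only if every index
-- is marked, and then the second branch is never used.
theorem groverAmp_eq (S : J → Prop) {θ : ℝ}
    (hθ : Real.sin θ ^ 2 * Fintype.card J = (Finset.univ.filter S).card)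
    (hs : Real.sin θ ≠ 0) (hc : (∃ j, ¬ S j) → Real.cos θ ≠ 0) (l : ℕ) (j : J) :
    groverAmp S l j = if S j then Real.sin ((2 * l + 1) * θ) / (Real.sin θ * √(Fintype.card J))
      else Real.cos ((2 * l + 1) * θ) / (Real.cos θ * √(Fintype.card J)) := by
  have hN : (0 : ℝ) < Fintype.card J := by
    have : Nonempty J := ⟨j⟩
    exact_mod_cast Fintype.card_pos
  have hN2 : √(Fintype.card J : ℝ) ^ 2 = Fintype.card J := Real.sq_sqrt hN.le
  have hN0 : 0 < √(Fintype.card J : ℝ) := Real.sqrt_pos.2 hN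
  induction l generalizing j with
  | zero =>
    rw [groverAmp]
    split_ifs with h
    · field_simp
      simp
    · have := hc ⟨j, h⟩
      field_simp
      simp
  | succ l ih =>
    set φ := (2 * (l : ℝ) + 1) * θ with hφ
    have hφ' : (2 * ((l + 1 : ℕ) : ℝ) + 1) * θ = φ + 2 * θ := by
      rw [hφ]
      push_cast
      ring
    have hcomp : Real.cos θ ^ 2 * Fintype.card J =
        (Finset.univ.filter fun j => ¬ S j).card := by
      have h1 := Finset.card_filter_add_card_filter_not (s := (Finset.univ : Finset J)) S
      rw [Finset.card_univ] at h1
      have h2 : ((Finset.univ.filter S).card : ℝ) +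
        (Finset.univ.filter fun j => ¬ S j).card = Fintype.card J := by exact_mod_cast h1
      rw [Real.cos_sq']
      linarith
    have hsum : ∑ k, (if S k then -1 else 1) * groverAmp S l k =
        √(Fintype.card J : ℝ) * Real.cos (φ + θ) := by
      have h1 : ∀ k, (if S k then -1 else 1) * groverAmp S l k =
          if S k then -(Real.sin φ / (Real.sin θ * √(Fintype.card J)))
          else Real.cos φ / (Real.cos θ * √(Fintype.card J)) := by
        intro k
        rw [ih]
        split_ifs <;> ring
      simp only [h1]
      rw [Finset.sum_ite, Finset.sum_const, Finset.sum_const, nsmul_eq_mul, nsmul_eq_mul, ← hθ,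
        ← hcomp, Real.cos_add, ← hN2]
      have h2 : Real.cos θ ^ 2 * √(Fintype.card J : ℝ) ^ 2 *
          (Real.cos φ / (Real.cos θ * √(Fintype.card J : ℝ))) =
          √(Fintype.card J : ℝ) * (Real.cos φ * Real.cos θ) := by
        by_cases h : Real.cos θ = 0
        · simp [h]
        · field_simp
      have h3 : Real.sin θ ^ 2 * √(Fintype.card J : ℝ) ^ 2 *
          -(Real.sin φ / (Real.sin θ * √(Fintype.card J : ℝ))) =
          -(√(Fintype.card J : ℝ) * (Real.sin φ * Real.sin θ)) := by
        field_simp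
      rw [Real.sqrt_sq hN0.le, h2, h3]
      ring
    have hdiv : 2 * (√(Fintype.card J : ℝ) * Real.cos (φ + θ)) / Fintype.card J =
        2 * Real.cos (φ + θ) / √(Fintype.card J : ℝ) := by
      rw [div_eq_div_iff hN.ne' hN0.ne']
      linear_combination (2 * Real.cos (φ + θ)) * hN2
    rw [groverAmp, hsum, hφ', ih, hdiv]
    have hadd : φ + 2 * θ = (φ + θ) + θ := by ring
    have hsub : φ = (φ + θ) - θ := by ring
    split_ifs with h
    · have h1 : Real.sin (φ + 2 * θ) = 2 * Real.cos (φ + θ) * Real.sin θ + Real.sin φ := by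
        rw [hadd, Real.sin_add]
        nth_rewrite 4 [hsub]
        rw [Real.sin_sub]
        ring
      rw [h1]
      field_simp
      ring
    · have := hc ⟨j, h⟩
      have h1 : Real.cos (φ + 2 * θ) = 2 * Real.cos (φ + θ) * Real.cos θ - Real.cos φ := by
        rw [hadd, Real.cos_add]
        nth_rewrite 4 [hsub]
        rw [Real.cos_sub]
        ring
      rw [h1]
      field_simp

end trig

section success

variable {J : Type} [Fintype J]

open Classical in
theorem exists_groverAngle (S : J → Prop) (hS : ∃ j, S j) :
    ∃ θ : ℝ, Real.sin θ ^ 2 * Fintype.card J = (Finset.univ.filter S).card ∧ 0 < Real.sin θ ∧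
      0 ≤ Real.cos θ ∧ ((∃ j, ¬ S j) → Real.cos θ ≠ 0) := by
  obtain ⟨j, hj⟩ := hS
  have hN : (0 : ℝ) < Fintype.card J := by
    have : Nonempty J := ⟨j⟩
    exact_mod_cast Fintype.card_pos
  have ht : (0 : ℝ) < (Finset.univ.filter S).card := by
    exact_mod_cast Finset.card_pos.2 ⟨j, by simpa using hj⟩
  have htN : ((Finset.univ.filter S).card : ℝ) ≤ Fintype.card J := by
    exact_mod_cast Finset.card_le_univ _
  set r : ℝ := (Finset.univ.filter S).card / Fintype.card J with hr
  have hr0 : 0 < r := div_pos ht hN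
  have hr1 : r ≤ 1 := (div_le_one hN).2 htN
  have hsin : Real.sin (Real.arcsin √r) = √r :=
    Real.sin_arcsin ((by norm_num : (-1 : ℝ) ≤ 0).trans (Real.sqrt_nonneg r))
      (Real.sqrt_le_one.2 hr1)
  refine ⟨Real.arcsin √r, ?_, ?_, Real.cos_arcsin_nonneg _, ?_⟩
  · rw [hsin, Real.sq_sqrt hr0.le, hr]
    field_simp
  · rw [hsin]
    exact Real.sqrt_pos.2 hr0
  · rintro ⟨k, hk⟩
    have hlt : r < 1 := by
      rw [hr, div_lt_one hN]
      exact_mod_cast Finset.card_lt_univ_of_notMem (x := k) (by simpa using hk)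
    rw [Real.cos_arcsin, Real.sq_sqrt hr0.le]
    exact (Real.sqrt_pos.2 (by linarith)).ne'

/-- Since `sin² = (1 - cos (2 ·)) / 2`, multiplying by `sin (2 * θ)` makes the cosine sum telescope.
-/
theorem sin_two_mul_mul_sum_sin_sq (θ : ℝ) (M : ℕ) :
    Real.sin (2 * θ) * ∑ l ∈ Finset.range M, Real.sin ((2 * l + 1) * θ) ^ 2 =
      Real.sin (2 * θ) * (M / 2) - Real.sin (4 * M * θ) / 4 := by
  induction M with
  | zero => simp
  | succ M ih =>
    rw [Finset.sum_range_succ, mul_add, ih]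
    have h1 : Real.sin (4 * ((M + 1 : ℕ) : ℝ) * θ) =
        Real.sin (2 * ((2 * M + 1) * θ) + 2 * θ) := by
      congr 1
      push_cast
      ring
    have h2 : Real.sin (4 * (M : ℝ) * θ) = Real.sin (2 * ((2 * M + 1) * θ) - 2 * θ) := by
      congr 1
      ring
    rw [h1, h2, Real.sin_add, Real.sin_sub, Real.sin_sq_eq_half_sub]
    push_cast
    ring

/-- A random number of iterations avoids having to know the number of marked indices. The average
over `l` alone is controlled only when `sin (2 * θ)` is not small; the term `M * sin² θ`, which
stands for plain sampling without iterations, covers large `θ`. -/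
theorem sum_sin_sq_ge {θ : ℝ} (hs : 0 < Real.sin θ) (hc : 0 ≤ Real.cos θ) {M : ℕ}
    (hM : 1 ≤ M * Real.sin θ) :
    (M : ℝ) / 4 ≤ M * Real.sin θ ^ 2 + ∑ l ∈ Finset.range M, Real.sin ((2 * l + 1) * θ) ^ 2 := by
  have h0 : 0 ≤ ∑ l ∈ Finset.range M, Real.sin ((2 * l + 1) * θ) ^ 2 :=
    Finset.sum_nonneg fun _ _ => sq_nonneg _
  have hM0 : (0 : ℝ) ≤ M := Nat.cast_nonneg M
  by_cases h : 1 / 4 ≤ Real.sin θ ^ 2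
  · nlinarith
  · have hcos : 3 / 4 < Real.cos θ := by
      have := Real.sin_sq_add_cos_sq θ
      nlinarith
    have h2 : 0 < Real.sin (2 * θ) := by
      rw [Real.sin_two_mul]
      positivity
    have key := sin_two_mul_mul_sum_sin_sq θ M
    have h3 := Real.sin_le_one (4 * M * θ)
    have h4 : 1 ≤ Real.sin (2 * θ) * M := by
      rw [Real.sin_two_mul]
      nlinarith
    have h5 : (M : ℝ) / 4 ≤ ∑ l ∈ Finset.range M, Real.sin ((2 * l + 1) * θ) ^ 2 := by
      refine le_of_mul_le_mul_left ?_ h2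
      rw [key]
      linarith
    have := mul_nonneg hM0 (sq_nonneg (Real.sin θ))
    linarith

open Classical in
-- Here `σ l` is the success probability after `l` iterations. It is spread evenly over the marked
-- indices, so a successful search yields a uniformly random marked index.
theorem exists_groverAmp_sq (S : J → Prop) (hS : ∃ j, S j) :
    ∃ σ : ℕ → ℝ, (∀ l, 0 ≤ σ l) ∧
      (∀ l j, S j → groverAmp S l j ^ 2 = σ l / (Finset.univ.filter S).card) ∧
      ∀ M : ℕ, (Fintype.card J : ℝ) ≤ (Finset.univ.filter S).card * M ^ 2 →
        (M : ℝ) / 4 ≤ M * σ 0 + ∑ l ∈ Finset.range M, σ l := by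
  obtain ⟨θ, h1, h2, h3, h4⟩ := exists_groverAngle S hS
  have hN : (0 : ℝ) < Fintype.card J := by
    have : Nonempty J := ⟨hS.choose⟩
    exact_mod_cast Fintype.card_pos
  refine ⟨fun l => Real.sin ((2 * l + 1) * θ) ^ 2, fun l => sq_nonneg _, fun l j hj => ?_,
    fun M hM => ?_⟩
  · rw [groverAmp_eq S h1 h2.ne' h4, if_pos hj, div_pow, mul_pow, Real.sq_sqrt hN.le, h1]
  · have := sum_sin_sq_ge (M := M) h2 h3 (by
      rw [← h1] at hM
      have : 1 ≤ (M * Real.sin θ) ^ 2 := by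
        rw [← mul_le_mul_iff_left₀ hN]
        linarith
      exact (one_le_sq_iff₀ (by positivity)).1 this)
    simpa using this

end success

/-! ### Optimum finding by Grover searches with rising thresholds. -/

section pairs

open Classical in
-- Of the two ordered versions of a pair of improving indices at most one is related by `R`.
-- Consequently a uniformly random improving index leaves, on average, at most half as many indices
-- that improve further.
theorem two_mul_sum_card_filter_le {J V : Type} [Fintype J] (R : V → V → Prop) [IsStrictOrder V R]
    (v : J → V) (τ : V) :
    2 * ∑ j with R τ (v j), (Finset.univ.filter fun k => R (v j) (v k)).card ≤
      (Finset.univ.filter fun j => R τ (v j)).card ^ 2 := by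
  set T := Finset.univ.filter fun j => R τ (v j) with hT
  have h1 : ∀ j ∈ T, (Finset.univ.filter fun k => R (v j) (v k)).card ≤
      ∑ k ∈ T, if R (v j) (v k) then 1 else 0 := by
    intro j hj
    rw [← Finset.card_filter]
    refine Finset.card_le_card fun k hk => ?_
    simp only [hT, Finset.mem_filter, Finset.mem_univ, true_and] at hj hk ⊢
    exact ⟨trans_of R hj hk, hk⟩
  calc _ ≤ 2 * ∑ j ∈ T, ∑ k ∈ T, (if R (v j) (v k) then 1 else 0) :=
        Nat.mul_le_mul_left _ (Finset.sum_le_sum h1)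
    _ = ∑ j ∈ T, ∑ k ∈ T, ((if R (v j) (v k) then 1 else 0) + if R (v k) (v j) then 1 else 0) := by
        simp only [Finset.sum_add_distrib]
        rw [two_mul]
        congr 1
        exact Finset.sum_comm
    _ ≤ ∑ j ∈ T, ∑ k ∈ T, 1 := by
        refine Finset.sum_le_sum fun j _ => Finset.sum_le_sum fun k _ => ?_
        by_cases h : R (v j) (v k)
        · simp [h, asymm_of R h]
        · simp only [h, if_false, zero_add]
          split_ifs <;> simp
    _ = T.card ^ 2 := by simp [sq]

end pairs

namespace QAlg

variable {ι α : Type} [Fintype ι] [Fintype α] [DecidableEq ι] [DecidableEq α] [AddCommGroup α]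

/-- A uniformly random element of `Fin (m + 1)`. -/
noncomputable def coin (i₀ : ι) (m : ℕ) : QAlg ι α (Fin (m + 1)) :=
  .run ⟨m + 1, (i₀, 0, 0), 0, fun _ => prepareUniform (fun c => (i₀, 0, c))
    (fun _ _ h => congrArg (fun b => b.2.2) h) 0⟩ fun b => .ret b.2.2

theorem expect_coin (i₀ : ι) (m : ℕ) (x : ι → α) (F : Fin (m + 1) → ℝ) :
    (coin i₀ m).expect x F = (∑ c, F c) / (m + 1) := by
  have hinj : Function.Injective fun c : Fin (m + 1) => ((i₀, 0, c) : QBasis ι α (m + 1)) :=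
    fun _ _ h => congrArg (fun b => b.2.2) h
  have h := QCircuit.sum_prob_mul_of_state (i₀, 0, 0) 0 (fun _ => prepareUniform _ hinj 0) x hinj
    (prepareUniform_mulVec _ hinj 0) fun b => F b.2.2
  refine Eq.trans ?_ (h.trans ?_)
  · rfl
  · simp only [div_pow, one_pow, Fintype.card_fin]
    rw [Real.sq_sqrt (Nat.cast_nonneg _), ← Finset.mul_sum]
    push_cast
    ring

@[simp] theorem expectedTime_coin (i₀ : ι) (m : ℕ) (x : ι → α) :
    (coin i₀ m : QAlg ι α _).expectedTime x = 0 := by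
  simp [coin, expectedTime]

/-- The input at position `i`. -/
noncomputable def ask (i : ι) : QAlg ι α α :=
  .run ⟨1, (i, 0, 0), 1, fun _ => 1⟩ fun b => .ret b.2.1

theorem expect_ask (i : ι) (x : ι → α) (F : α → ℝ) : (ask i).expect x F = F (x i) := by
  have h1 : Pi.single (i, 0, 0) 1 =
      spread (fun _ : Unit => ((i, 0, 0) : QBasis ι α 1)) fun _ => 1 := by
    simp [spread]
  have h := QCircuit.sum_prob_mul_of_state (J := Unit) (a := fun _ => 1)
    (φ := fun _ => (i, x i, 0)) (i, 0, 0) 1 (fun _ => 1) x (fun _ _ _ => rfl) (by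
      rw [QCircuit.state_mk_succ, QCircuit.state_mk_zero, Matrix.UnitaryGroup.one_val,
        Matrix.one_mulVec, Matrix.one_mulVec, h1, queryOp_spread]
      simp) fun b => F b.2.1
  refine Eq.trans ?_ (h.trans ?_)
  · rfl
  · simp

@[simp] theorem expectedTime_ask (i : ι) (x : ι → α) :
    (ask i : QAlg ι α α).expectedTime x = 1 := by
  simp [ask, expectedTime]

end QAlg

namespace Probe

variable {J ι α V : Type} [Fintype ι] [Fintype α] [DecidableEq ι] [DecidableEq α] [AddCommGroup α]

/-- Reads the value at `j` with two queries. -/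
noncomputable def eval (L : Probe J ι α V) (j : J) : QAlg ι α V :=
  (QAlg.ask (L.fst j)).bind fun u => (QAlg.ask (L.snd j u)).bind fun z => .ret (L.out j u z)

theorem expect_eval (L : Probe J ι α V) (j : J) (x : ι → α) (F : V → ℝ) :
    (L.eval j).expect x F = F (L.value x j) := by
  simp only [eval, QAlg.expect_bind, QAlg.expect_ask, QAlg.expect_ret, value]

theorem expectedTime_eval (L : Probe J ι α V) (j : J) (x : ι → α) :
    (L.eval j).expectedTime x = 2 := by
  simp only [eval, QAlg.expectedTime_bind, QAlg.expect_ask, QAlg.expectedTime_ask,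
    QAlg.expectedTime_ret]
  norm_num

end Probe

open Classical in
/-- The better one of two values. -/
noncomputable def improve {V : Type} (R : V → V → Prop) (τ v : V) : V := if R τ v then v else τ

theorem one_le_growth_pow (r : ℕ) : (1 : ℝ) ≤ (41 / 40) ^ r := one_le_pow₀ (by norm_num)

/-- With growth factor `41 / 40`, the first bound brings the expected number of better values `5 * N
/ ((41 / 40) ^ r) ^ 2` down to `1 / 10`, while the second keeps the cost `O(√N)`. -/
theorem exists_rounds (N : ℕ) : ∃ r : ℕ, 1 ≤ N →
    50 * (N : ℝ) ≤ ((41 / 40) ^ r) ^ 2 ∧ (41 / 40 : ℝ) ^ r ≤ 8 * √N := by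
  by_cases hN : 1 ≤ N
  · have hN' : (1 : ℝ) ≤ N := by exact_mod_cast hN
    obtain ⟨n, h1, h2⟩ := exists_nat_pow_near (x := √(50 * (N : ℝ))) (y := 41 / 40)
      (Real.one_le_sqrt.2 (by linarith)) (by norm_num)
    refine ⟨n + 1, fun _ => ⟨?_, ?_⟩⟩
    · exact (Real.sqrt_le_left (by positivity)).1 h2.le
    · have h3 : √(50 * (N : ℝ)) ≤ 15 / 2 * √N := by
        rw [Real.sqrt_mul (by norm_num)]
        gcongr
        exact Real.sqrt_le_iff.2 ⟨by norm_num, by norm_num⟩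
      have := Real.sqrt_nonneg (N : ℝ)
      rw [pow_succ]
      linarith
  · exact ⟨0, fun h => absurd h hN⟩

/-- Number of search steps for a list of `N` values. -/
noncomputable def rounds (N : ℕ) : ℕ := (exists_rounds N).choose

namespace Probe

variable {J ι α V : Type} [Fintype J] [Fintype ι] [Fintype α] [DecidableEq J] [DecidableEq ι]
  [DecidableEq α] [AddCommGroup α]

/-- Grover search for a value that improves on the threshold `τ`, with a random number of at most
`m` iterations. -/
noncomputable def climbStep (L : Probe J ι α V) (R : V → V → Prop) (j₀ : J) (m : ℕ) (τ : V) :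
    QAlg ι α V :=
  -- Half of the `2 * m + 2` outcomes give a uniform number of iterations in `0, …, m`; the other
  -- half give zero iterations, which is the plain sampling needed in `sum_sin_sq_ge`.
  (QAlg.coin (L.fst j₀) (2 * m + 1)).bind fun c =>
    ((L.map (R τ)).grover j₀ (if (c : ℕ) < m + 1 then c else 0)).bind fun j =>
      (L.eval j).bind fun v => .ret (improve R τ v)

/-- Successive search steps with a geometrically growing number of iterations. -/
noncomputable def climb (L : Probe J ι α V) (R : V → V → Prop) (j₀ : J) : ℕ → V → QAlg ι α V
  | 0, τ => .ret τ
  | r + 1, τ => (L.climb R j₀ r τ).bind (L.climbStep R j₀ ⌊(41 / 40 : ℝ) ^ r⌋₊)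

/-- `k` successive climbs. -/
noncomputable def climbs (L : Probe J ι α V) (R : V → V → Prop) (j₀ : J) : ℕ → V → QAlg ι α V
  | 0, τ => .ret τ
  | k + 1, τ => (L.climbs R j₀ k τ).bind (L.climb R j₀ (rounds (Fintype.card J)))

/-- Quantum optimum finding: `k` climbs that start from the value at `j₀`. -/
noncomputable def optimize (L : Probe J ι α V) (R : V → V → Prop) (j₀ : J) (k : ℕ) : QAlg ι α V :=
  (L.eval j₀).bind (L.climbs R j₀ k)

variable (L : Probe J ι α V) (R : V → V → Prop) (j₀ : J) (x : ι → α)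

theorem expect_climbStep (m : ℕ) (τ : V) (F : V → ℝ) :
    (L.climbStep R j₀ m τ).expect x F = (∑ l ∈ Finset.range (m + 1),
      ∑ j, groverAmp (fun k => R τ (L.value x k)) l j ^ 2 * F (improve R τ (L.value x j)) +
      (m + 1) * ∑ j, groverAmp (fun k => R τ (L.value x k)) 0 j ^ 2 *
        F (improve R τ (L.value x j))) / (2 * (m + 1)) := by
  simp only [climbStep, QAlg.expect_bind, QAlg.expect_coin, expect_grover, expect_eval,
    QAlg.expect_ret]
  have hv : (L.map (R τ)).value x = fun k => R τ (L.value x k) := rfl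
  rw [hv]
  set G : ℕ → ℝ := fun l => ∑ j, groverAmp (fun k => R τ (L.value x k)) l j ^ 2 *
    F (improve R τ (L.value x j)) with hG
  have h1 : ∑ c : Fin (2 * m + 1 + 1), G (if (c : ℕ) < m + 1 then c else 0) =
      ∑ l ∈ Finset.range (m + 1), G l + (m + 1) * G 0 := by
    rw [Fin.sum_univ_eq_sum_range (fun c => G (if c < m + 1 then c else 0)),
      show 2 * m + 1 + 1 = (m + 1) + (m + 1) by ring, Finset.sum_range_add]
    congr 1
    · refine Finset.sum_congr rfl fun l hl => ?_
      rw [if_pos (Finset.mem_range.1 hl)]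
    · have hlt : ∀ l, ¬ m + 1 + l < m + 1 := fun l => by lia
      simp only [hlt, if_false, Finset.sum_const, Finset.card_range, nsmul_eq_mul]
      push_cast
      ring
  rw [h1]
  congr 1
  push_cast
  ring

theorem expectedTime_climbStep (m : ℕ) (τ : V) :
    (L.climbStep R j₀ m τ).expectedTime x =
      (∑ c : Fin (2 * m + 1 + 1), 4 * (if (c : ℕ) < m + 1 then (c : ℝ) else 0)) /
        ((2 * m + 1 : ℕ) + 1) + 2 := by
  have h : ∀ c : Fin (2 * m + 1 + 1), (((L.map (R τ)).grover j₀
      (if (c : ℕ) < m + 1 then c else 0)).bind fun j =>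
      (L.eval j).bind fun v => .ret (improve R τ v)).expectedTime x =
      4 * (if (c : ℕ) < m + 1 then (c : ℝ) else 0) + 2 := by
    intro c
    simp only [QAlg.expectedTime_bind, expectedTime_grover, expectedTime_eval,
      QAlg.expectedTime_ret, QAlg.expect_const]
    split_ifs <;> simp
  simp only [climbStep]
  rw [QAlg.expectedTime_bind]
  simp only [h]
  rw [QAlg.expectedTime_coin, QAlg.expect_add, QAlg.expect_const, QAlg.expect_coin, zero_add]

theorem expectedTime_climbStep_le (m : ℕ) (τ : V) :
    (L.climbStep R j₀ m τ).expectedTime x ≤ 4 * m + 2 := by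
  rw [expectedTime_climbStep]
  gcongr
  rw [div_le_iff₀ (by positivity)]
  refine (Finset.sum_le_card_nsmul _ _ (4 * m : ℝ) fun c _ => ?_).trans_eq ?_
  · split_ifs with h
    · have : ((c : ℕ) : ℝ) ≤ m := by exact_mod_cast Nat.lt_succ_iff.1 h
      linarith
    · simp
  · simp
    ring

theorem surely_climbStep (m : ℕ) (τ : V) : (L.climbStep R j₀ m τ).Surely x fun v =>
    (v = τ ∨ v ∈ Set.range (L.value x)) ∧ (v = τ ∨ R τ v) := by
  refine (QAlg.surely_true _ x).bind fun c _ => (QAlg.surely_true _ x).bind fun j _ =>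
    QAlg.Surely.bind (P := fun v => v = L.value x j) ?_ ?_
  · refine QAlg.surely_of_probOf_eq_zero ?_
    rw [QAlg.probOf, expect_eval]
    simp
  · rintro _ rfl
    simp only [QAlg.surely_ret, improve]
    split_ifs with h
    · exact ⟨Or.inr ⟨j, rfl⟩, Or.inr h⟩
    · exact ⟨Or.inl rfl, Or.inl rfl⟩

open Classical in
/-- Number of indices whose value improves on `τ`. -/
noncomputable def numBetter (τ : V) : ℕ := (Finset.univ.filter fun j => R τ (L.value x j)).card

variable [IsStrictOrder V R]

open Classical in
-- With enough iterations the step succeeds with probability at least `1 / 8`, and success halves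
-- the number of better indices on average: a factor `1 - 1 / 16`. With too few iterations that
-- number is already below `N / (m + 1) ^ 2`, so the additive term pays for making no progress.
theorem expect_numBetter_climbStep_le (m : ℕ) (τ : V) :
    (L.climbStep R j₀ m τ).expect x (fun v => (L.numBetter R x v : ℝ)) ≤
      15 / 16 * L.numBetter R x τ + Fintype.card J / (16 * (m + 1) ^ 2) := by
  have htriv : (L.climbStep R j₀ m τ).expect x (fun v => (L.numBetter R x v : ℝ)) ≤
      L.numBetter R x τ := by
    rw [← QAlg.expect_const (L.climbStep R j₀ m τ) x (L.numBetter R x τ : ℝ)]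
    refine (L.surely_climbStep R j₀ x m τ).expect_le fun v hv => ?_
    obtain ⟨-, rfl | hv⟩ := hv
    · exact le_rfl
    · refine Nat.cast_le.2 (Finset.card_le_card fun j hj => ?_)
      simp only [Finset.mem_filter, Finset.mem_univ, true_and] at hj ⊢
      exact trans_of R hv hj
  by_cases hM : (Fintype.card J : ℝ) ≤ L.numBetter R x τ * ((m + 1 : ℕ) : ℝ) ^ 2
  swap
  · have h1 : (L.numBetter R x τ : ℝ) ≤ Fintype.card J / (m + 1) ^ 2 := by
      rw [le_div_iff₀ (by positivity)]
      push_cast at hM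
      linarith
    have h2 : (Fintype.card J : ℝ) / (16 * (m + 1) ^ 2) = (Fintype.card J / (m + 1) ^ 2) / 16 := by
      field_simp
    rw [h2]
    linarith
  by_cases hS : ∃ j, R τ (L.value x j)
  swap
  · have h0 : L.numBetter R x τ = 0 := by
      rw [numBetter, Finset.card_eq_zero, Finset.filter_eq_empty_iff]
      exact fun j _ h => hS ⟨j, h⟩
    rw [h0] at htriv ⊢
    refine htriv.trans ?_
    push_cast
    positivity
  obtain ⟨σ, h1, h2, h3⟩ := exists_groverAmp_sq (fun j => R τ (L.value x j)) hS
  set t : ℝ := (L.numBetter R x τ : ℝ) with ht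
  have ht0 : 0 < t := by
    obtain ⟨j, hj⟩ := hS
    exact Nat.cast_pos.2 (Finset.card_pos.2 ⟨j, by simpa using hj⟩)
  have key : ∀ l, ∑ j, groverAmp (fun k => R τ (L.value x k)) l j ^ 2 *
      (L.numBetter R x (improve R τ (L.value x j)) : ℝ) ≤ t * (1 - σ l / 2) := by
    intro l
    have hsum : ∑ j, groverAmp (fun k => R τ (L.value x k)) l j ^ 2 = 1 := by
      have := expect_grover (L.map (R τ)) j₀ x l fun _ => 1
      rw [QAlg.expect_const] at this
      simp only [mul_one] at this
      exact this.symm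
    have e1 : ∀ j, groverAmp (fun k => R τ (L.value x k)) l j ^ 2 *
        (L.numBetter R x (improve R τ (L.value x j)) : ℝ) =
        groverAmp (fun k => R τ (L.value x k)) l j ^ 2 * t +
          if R τ (L.value x j) then σ l / t * (L.numBetter R x (L.value x j) : ℝ) - σ l
          else 0 := by
      intro j
      by_cases hj : R τ (L.value x j)
      · have e2 : groverAmp (fun k => R τ (L.value x k)) l j ^ 2 = σ l / t := h2 l j hj
        rw [e2, improve, if_pos hj, if_pos hj]
        field_simp
        ring
      · rw [improve, if_neg hj, if_neg hj, add_zero]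
    simp only [e1]
    rw [Finset.sum_add_distrib, ← Finset.sum_mul, hsum, ← Finset.sum_filter,
      Finset.sum_sub_distrib, ← Finset.mul_sum, Finset.sum_const, nsmul_eq_mul]
    have e3 : ∑ j with R τ (L.value x j), (L.numBetter R x (L.value x j) : ℝ) ≤ t ^ 2 / 2 := by
      have := two_mul_sum_card_filter_le R (L.value x) τ
      have : (2 : ℝ) * ∑ j with R τ (L.value x j), (L.numBetter R x (L.value x j) : ℝ) ≤ t ^ 2 := by
        rw [ht]
        exact_mod_cast this
      linarith
    have e4 : σ l / t * ∑ j with R τ (L.value x j), (L.numBetter R x (L.value x j) : ℝ) ≤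
        σ l / t * (t ^ 2 / 2) := mul_le_mul_of_nonneg_left e3 (div_nonneg (h1 l) ht0.le)
    have e5 : σ l / t * (t ^ 2 / 2) = σ l * t / 2 := by
      field_simp
    have e6 : ((Finset.univ.filter fun j => R τ (L.value x j)).card : ℝ) = t := rfl
    rw [e6]
    linarith
  have hσ := h3 (m + 1) hM
  rw [expect_climbStep]
  have hle : ∑ l ∈ Finset.range (m + 1), ∑ j, groverAmp (fun k => R τ (L.value x k)) l j ^ 2 *
      (L.numBetter R x (improve R τ (L.value x j)) : ℝ) ≤
      t * ((m + 1) - (∑ l ∈ Finset.range (m + 1), σ l) / 2) := by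
    refine (Finset.sum_le_sum fun l _ => key l).trans_eq ?_
    rw [← Finset.mul_sum, Finset.sum_sub_distrib, ← Finset.sum_div]
    simp
  have hle0 := mul_le_mul_of_nonneg_left (key 0) (by positivity : (0 : ℝ) ≤ m + 1)
  have hpos : (0 : ℝ) ≤ Fintype.card J / (16 * (m + 1) ^ 2) := by positivity
  refine le_trans ?_ (le_add_of_nonneg_right hpos)
  rw [div_le_iff₀ (by positivity)]
  push_cast at hσ
  have := mul_le_mul_of_nonneg_left hσ ht0.le
  nlinarith

omit [IsStrictOrder V R] in
theorem surely_climb_mem (r : ℕ) (τ : V) :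
    (L.climb R j₀ r τ).Surely x fun v => v = τ ∨ v ∈ Set.range (L.value x) := by
  induction r with
  | zero => exact Or.inl rfl
  | succ r ih =>
    refine ih.bind fun v hv => (L.surely_climbStep R j₀ x _ v).mono fun v' hv' => ?_
    obtain ⟨rfl | h, -⟩ := hv'
    · exact hv
    · exact Or.inr h

theorem surely_climb_better (r : ℕ) (τ : V) :
    (L.climb R j₀ r τ).Surely x fun v => v = τ ∨ R τ v := by
  induction r with
  | zero => exact Or.inl rfl
  | succ r ih =>
    refine ih.bind fun v hv => (L.surely_climbStep R j₀ x _ v).mono fun v' hv' => ?_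
    obtain ⟨-, rfl | h⟩ := hv'
    · exact hv
    · rcases hv with rfl | hv
      · exact Or.inr h
      · exact Or.inr (trans_of R hv h)

/-- The potential obeys `E ↦ 15 / 16 * E + N / (16 * y ^ 2)` with `y = (41 / 40) ^ r`. The bound `5
* N / y ^ 2` survives because `5 * 15 / 16 + 1 / 16 = 19 / 4` is at most `5 / (41 / 40) ^ 2`. -/
theorem expect_numBetter_climb_le (r : ℕ) (τ : V) :
    (L.climb R j₀ r τ).expect x (fun v => (L.numBetter R x v : ℝ)) ≤
      5 * Fintype.card J / ((41 / 40) ^ r) ^ 2 := by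
  have hN : (0 : ℝ) ≤ Fintype.card J := Nat.cast_nonneg _
  induction r with
  | zero =>
    have : (L.numBetter R x τ : ℝ) ≤ Fintype.card J := by exact_mod_cast Finset.card_le_univ _
    simp only [climb, QAlg.expect_ret]
    linarith
  | succ r ih =>
    rw [climb, QAlg.expect_bind]
    refine (QAlg.expect_mono _ x fun v =>
      L.expect_numBetter_climbStep_le R j₀ x ⌊(41 / 40 : ℝ) ^ r⌋₊ v).trans ?_
    rw [QAlg.expect_add, QAlg.expect_const]
    simp only [mul_comm (15 / 16 : ℝ)]
    rw [QAlg.expect_mul_const]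
    have hρ := one_le_growth_pow r
    set y : ℝ := (41 / 40) ^ r with hy
    have h1 : (Fintype.card J : ℝ) / (16 * ((⌊y⌋₊ : ℝ) + 1) ^ 2) ≤ Fintype.card J / (16 * y ^ 2) := by
      gcongr
      exact (Nat.lt_floor_add_one y).le
    have h2 : 5 * (Fintype.card J : ℝ) / y ^ 2 * (15 / 16) + Fintype.card J / (16 * y ^ 2) =
        19 / 4 * (Fintype.card J / y ^ 2) := by
      field_simp
      ring
    have h3 : 5 * (Fintype.card J : ℝ) / ((41 / 40) ^ (r + 1)) ^ 2 =
        8000 / 1681 * (Fintype.card J / y ^ 2) := by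
      rw [pow_succ (41 / 40 : ℝ) r, ← hy]
      field_simp
      ring
    rw [h3]
    have h4 : 0 ≤ (Fintype.card J : ℝ) / y ^ 2 := by positivity
    linarith

/-- Markov's inequality: a non-optimal outcome has at least one better index. -/
theorem probOf_climb_rounds_le (τ : V) :
    (L.climb R j₀ (rounds (Fintype.card J)) τ).probOf x (fun v => ∃ j, R v (L.value x j)) ≤
      1 / 10 := by
  classical
  have : Nonempty J := ⟨j₀⟩
  have hN : (0 : ℝ) < Fintype.card J := by exact_mod_cast Fintype.card_pos
  obtain ⟨h1, -⟩ := (exists_rounds (Fintype.card J)).choose_spec Fintype.card_pos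
  refine le_trans ?_ ((L.expect_numBetter_climb_le R j₀ x (rounds (Fintype.card J)) τ).trans ?_)
  · refine QAlg.expect_mono _ x fun v => ?_
    split_ifs with h
    · obtain ⟨j, hj⟩ := h
      exact Nat.one_le_cast.2 (Finset.card_pos.2 ⟨j, by simpa using hj⟩)
    · exact Nat.cast_nonneg _
  · rw [div_le_iff₀ (by positivity)]
    change 50 * _ ≤ ((41 / 40 : ℝ) ^ rounds (Fintype.card J)) ^ 2 at h1
    linarith

theorem probOf_climbs_le (k : ℕ) (τ : V) :
    (L.climbs R j₀ k τ).probOf x (fun v => ∃ j, R v (L.value x j)) ≤ (1 / 10) ^ k := by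
  induction k with
  | zero => exact QAlg.probOf_le_one _ x _
  | succ k ih =>
    refine ((QAlg.surely_true _ x).probOf_bind_le_mul (Q := fun v => ∃ j, R v (L.value x j))
      (ε := 1 / 10) (fun v _ hv => ?_) fun v _ _ => L.probOf_climb_rounds_le R j₀ x v).trans ?_
    · refine ((L.surely_climb_better R j₀ x _ v).probOf_eq_zero fun v' hv' => ?_).le
      rintro ⟨j, hj⟩
      refine hv ⟨j, ?_⟩
      rcases hv' with rfl | hv'
      · exact hj
      · exact trans_of R hv' hj
    · rw [pow_succ]
      gcongr

omit [IsStrictOrder V R] in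
theorem surely_climbs_mem (k : ℕ) (τ : V) :
    (L.climbs R j₀ k τ).Surely x fun v => v = τ ∨ v ∈ Set.range (L.value x) := by
  induction k with
  | zero => exact Or.inl rfl
  | succ k ih =>
    refine ih.bind fun v hv => (L.surely_climb_mem R j₀ x _ v).mono fun v' hv' => ?_
    obtain rfl | h := hv'
    · exact hv
    · exact Or.inr h

omit [IsStrictOrder V R] in
theorem surely_optimize (k : ℕ) :
    (L.optimize R j₀ k).Surely x fun v => v ∈ Set.range (L.value x) := by
  refine QAlg.Surely.bind (P := fun v => v = L.value x j₀) ?_ ?_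
  · refine QAlg.surely_of_probOf_eq_zero ?_
    rw [QAlg.probOf, expect_eval]
    simp
  · rintro _ rfl
    refine (L.surely_climbs_mem R j₀ x k _).mono fun v hv => ?_
    rcases hv with rfl | h
    · exact ⟨j₀, rfl⟩
    · exact h

theorem probOf_optimize_le (k : ℕ) :
    (L.optimize R j₀ k).probOf x (fun v => ∃ j, R v (L.value x j)) ≤ (1 / 10) ^ k := by
  rw [optimize, QAlg.probOf, QAlg.expect_bind, expect_eval]
  exact L.probOf_climbs_le R j₀ x k _

omit [IsStrictOrder V R] in
-- Geometric series: a step costs at most `4 * y + 2 ≤ 6 * y` with `y = (41 / 40) ^ r`, and `6 / (41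
-- / 40 - 1) = 240`.
theorem expectedTime_climb_le (r : ℕ) (τ : V) :
    (L.climb R j₀ r τ).expectedTime x ≤ 240 * (41 / 40) ^ r := by
  induction r with
  | zero => simp [climb]
  | succ r ih =>
    have h1 := one_le_growth_pow r
    refine (QAlg.expectedTime_bind_le _ _ x (L.expectedTime_climbStep_le R j₀ x _)).trans ?_
    have h2 := Nat.floor_le (zero_le_one.trans h1)
    rw [pow_succ]
    linarith

omit [IsStrictOrder V R] in
theorem expectedTime_optimize_le (k : ℕ) :
    (L.optimize R j₀ k).expectedTime x ≤ 2 + 1920 * k * √(Fintype.card J) := by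
  have : Nonempty J := ⟨j₀⟩
  obtain ⟨-, h1⟩ := (exists_rounds (Fintype.card J)).choose_spec Fintype.card_pos
  have h2 : ∀ τ, (L.climbs R j₀ k τ).expectedTime x ≤ 1920 * k * √(Fintype.card J) := by
    intro τ
    induction k with
    | zero => simp [climbs]
    | succ k ih =>
      refine (QAlg.expectedTime_bind_le _ _ x fun v =>
        (L.expectedTime_climb_le R j₀ x _ v).trans (mul_le_mul_of_nonneg_left h1 (by norm_num))).trans
        ?_
      push_cast
      linarith
  refine (QAlg.expectedTime_bind_le _ _ x h2).trans_eq ?_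
  rw [expectedTime_eval]

section congr

variable {L R x} {L' : Probe J ι α V} {x' : ι → α}

omit [IsStrictOrder V R] in
-- The outcome distribution involves the input only through the computed values, as
-- `IsVertexRoutine` demands.
theorem expect_optimize_congr (h : L.value x = L'.value x') (k : ℕ) (F : V → ℝ) :
    (L.optimize R j₀ k).expect x F = (L'.optimize R j₀ k).expect x' F := by
  have h1 : ∀ r τ F, (L.climb R j₀ r τ).expect x F = (L'.climb R j₀ r τ).expect x' F := by
    intro r τ
    induction r with
    | zero => exact fun F => rfl
    | succ r ih =>
      intro F
      simp only [climb, QAlg.expect_bind, expect_climbStep, h]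
      exact ih _
  have h2 : ∀ k τ F, (L.climbs R j₀ k τ).expect x F = (L'.climbs R j₀ k τ).expect x' F := by
    intro k τ
    induction k with
    | zero => exact fun F => rfl
    | succ k ih =>
      intro F
      simp only [climbs, QAlg.expect_bind, h1]
      exact ih _
  simp only [optimize, QAlg.expect_bind, expect_eval, h, h2]

omit [IsStrictOrder V R] in
-- The iteration counts are drawn independently of the input, and each step's expected cost does not
-- depend on the threshold, so the expected time is a constant.
theorem expectedTime_optimize_congr (k : ℕ) :
    (L.optimize R j₀ k).expectedTime x = (L'.optimize R j₀ k).expectedTime x' := by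
  have h1 : ∀ r, ∃ T, ∀ τ, (L.climb R j₀ r τ).expectedTime x = T ∧
      (L'.climb R j₀ r τ).expectedTime x' = T := by
    intro r
    induction r with
    | zero => exact ⟨0, fun τ => ⟨rfl, rfl⟩⟩
    | succ r ih =>
      obtain ⟨T, hT⟩ := ih
      set m := ⌊(41 / 40 : ℝ) ^ r⌋₊ with hm
      refine ⟨T + ((∑ c : Fin (2 * m + 1 + 1), 4 * (if (c : ℕ) < m + 1 then (c : ℝ) else 0)) /
        ((2 * m + 1 : ℕ) + 1) + 2), fun τ => ?_⟩
      simp only [climb, QAlg.expectedTime_bind, expectedTime_climbStep, QAlg.expect_const, hT,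
        ← hm, and_self]
  have h2 : ∀ k, ∃ T, ∀ τ, (L.climbs R j₀ k τ).expectedTime x = T ∧
      (L'.climbs R j₀ k τ).expectedTime x' = T := by
    intro k
    induction k with
    | zero => exact ⟨0, fun τ => ⟨rfl, rfl⟩⟩
    | succ k ih =>
      obtain ⟨T, hT⟩ := ih
      obtain ⟨T', hT'⟩ := h1 (rounds (Fintype.card J))
      refine ⟨T + T', fun τ => ?_⟩
      simp only [climbs, QAlg.expectedTime_bind, hT', QAlg.expect_const, hT, and_self]
  obtain ⟨T, hT⟩ := h2 k
  simp only [optimize, QAlg.expectedTime_bind, expectedTime_eval, hT, QAlg.expect_const]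

end congr

end Probe

/-! ### Transition functions and the routine at a single vertex. -/

namespace Transition

variable {Val : Type} [LinearOrder Val]

/-- The value `v` is strictly better than `τ` for the transition function. -/
def Better (h : Transition) (τ v : Val) : Prop :=
  match h with
  | .max => τ < v
  | .min => v < τ

instance (h : Transition) : IsStrictOrder Val h.Better :=
  match h with
  | .max => inferInstanceAs (IsStrictOrder Val (· < ·))
  | .min => inferInstanceAs (IsStrictOrder Val (· > ·))

theorem isValue_iff {k : ℕ} {h : Transition} {u : Fin k → Val} {v : Val} :
    h.IsValue u v ↔ v ∈ Set.range u ∧ ∀ j, ¬ h.Better v (u j) := by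
  cases h <;> simp [IsValue, Better, IsGreatest, IsLeast, mem_upperBounds, mem_lowerBounds]

theorem not_better_trans {h : Transition} {a b c : Val} (hab : ¬ h.Better b a)
    (hbc : ¬ h.Better c b) : ¬ h.Better c a := by
  cases h <;> simp only [Better, not_lt] at *
  · exact hab.trans hbc
  · exact hbc.trans hab

theorem IsValue.unique {k : ℕ} {h : Transition} {u : Fin k → Val} {v v' : Val}
    (hv : h.IsValue u v) (hv' : h.IsValue u v') : v = v' := by
  cases h
  · exact IsGreatest.unique hv hv'
  · exact IsLeast.unique hv hv'

end Transition

section routine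

variable {n K : ℕ} [NeZero n] [NeZero K] {Val : Type} {d : Fin n → ℕ}

/-- The arguments of the transition function at `i`, read with two queries each. -/
def argumentProbe (val : Fin n → Fin K → Val) (t : Fin n → Val) (i : Fin n) :
    Probe (Fin (d i)) (Position d) (Fin n × Fin K) Val where
  fst k := .inl ⟨i, k⟩
  snd _ u := .inr u.1
  out _ u z := if d u.1 = 0 then val u.1 z.2 else t u.1

theorem argumentProbe_value (val : Fin n → Fin K → Val) (t : Fin n → Val) (i : Fin n)
    (D : AdjLists d) (y : Fin n → Fin K) :
    (argumentProbe val t i).value (inputString D y) = arguments val t D y i := rfl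

variable [LinearOrder Val]

/-- Quantum optimum finding for the transition function at `i`. -/
noncomputable def vertexRoutine (h : Fin n → Transition) (val : Fin n → Fin K → Val) (k : ℕ)
    (i : Fin n) (t : Fin n → Val) : DAGAlg d K Val :=
  if hi : d i ≠ 0 then
    (argumentProbe val t i).optimize (h i).Better ⟨0, Nat.pos_of_ne_zero hi⟩ k
  else .ret (t i)

variable (h : Fin n → Transition) (val : Fin n → Fin K → Val) (k : ℕ) {i : Fin n}
  (t : Fin n → Val) (D : AdjLists d) (y : Fin n → Fin K)

theorem surely_vertexRoutine (hi : d i ≠ 0) :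
    (vertexRoutine h val k i t).Surely (inputString D y)
      fun v => v ∈ Set.range (arguments val t D y i) := by
  rw [vertexRoutine, dif_pos hi, ← argumentProbe_value]
  exact Probe.surely_optimize _ _ _ _ _

theorem probOf_vertexRoutine_le (hi : d i ≠ 0) :
    (vertexRoutine h val k i t).probOf (inputString D y)
      (fun v => ¬ (h i).IsValue (arguments val t D y i) v) ≤ (1 / 10) ^ k := by
  refine ((surely_vertexRoutine h val k t D y hi).probOf_le (Q' := fun v =>
    ∃ j, (h i).Better v ((argumentProbe val t i).value (inputString D y) j))
    fun v hv hv' => ?_).trans ?_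
  · by_contra hcon
    exact hv' (Transition.isValue_iff.2 ⟨hv, fun j hj => hcon ⟨j, hj⟩⟩)
  · rw [vertexRoutine, dif_pos hi]
    exact Probe.probOf_optimize_le _ _ _ _ _

theorem expectedTime_vertexRoutine_le (hi : d i ≠ 0) (hk : 1 ≤ k) :
    (vertexRoutine h val k i t).expectedTime (inputString D y) ≤ 1922 * k * √(d i) := by
  rw [vertexRoutine, dif_pos hi]
  refine (Probe.expectedTime_optimize_le _ _ _ _ _).trans ?_
  rw [Fintype.card_fin]
  have h1 : 1 ≤ √(d i : ℝ) := Real.one_le_sqrt.2 (by exact_mod_cast Nat.pos_of_ne_zero hi)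
  have h2 : (1 : ℝ) ≤ k := by exact_mod_cast hk
  nlinarith

theorem isVertexRoutine_vertexRoutine (hi : d i ≠ 0) (hk : 1 ≤ k) :
    IsVertexRoutine (h i) val i (vertexRoutine (d := d) h val k i) := by
  refine ⟨fun t t' D D' y y' harg => ⟨fun v => ?_, ?_⟩, fun t D y v hv => ?_⟩
  · simp only [QAlg.prob_eq_expect, vertexRoutine, dif_pos hi]
    exact Probe.expect_optimize_congr (L := argumentProbe val t i) (x := inputString D y)
      (L' := argumentProbe val t' i) (x' := inputString D' y') _ harg _ _
  · simp only [vertexRoutine, dif_pos hi]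
    exact Probe.expectedTime_optimize_congr _ _
  · have h1 := QAlg.one_sub_prob (vertexRoutine h val k i t) (inputString D y) v
    have h2 := (QAlg.surely_true (vertexRoutine h val k i t) (inputString D y)).probOf_le
      (Q := fun o => o ≠ v) (Q' := fun v => ¬ (h i).IsValue (arguments val t D y i) v)
      fun o _ ho ho' => ho (ho'.unique hv)
    have h3 := probOf_vertexRoutine_le h val k t D y hi
    have h4 : (1 / 10 : ℝ) ^ k ≤ (1 / 10) ^ 1 :=
      pow_le_pow_of_le_one (by norm_num) (by norm_num) hk
    linarith

omit [NeZero n] [NeZero K] [LinearOrder Val] in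
theorem arguments_congr {D : AdjLists d} (hD : ∀ i k, i < D i k) {t t' : Fin n → Val}
    (ht : ∀ j, i < j → t j = t' j) : arguments val t D y i = arguments val t' D y i := by
  funext k
  simp only [arguments, ht _ (hD i k)]

omit [NeZero n] [LinearOrder Val] in
theorem expectedTime_sweep_le {ι α : Type} [Fintype ι] [Fintype α] [DecidableEq ι]
    [DecidableEq α] [AddCommGroup α] (Q : Fin n → (Fin n → Val) → QAlg ι α Val) (x : ι → α)
    (T : Fin n → ℝ) (l : List (Fin n)) (hT : ∀ i ∈ l, ∀ t, (Q i t).expectedTime x ≤ T i)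
    (t : Fin n → Val) : (sweep Q l t).expectedTime x ≤ (l.map T).sum := by
  induction l generalizing t with
  | nil => simp [sweep]
  | cons i l ih =>
    rw [List.map_cons, List.sum_cons, sweep]
    exact (QAlg.expectedTime_bind_le _ _ x fun v =>
      ih (fun j hj => hT j (List.mem_cons_of_mem _ hj)) _).trans
      (add_le_add_left (hT i List.mem_cons_self t) _)

end routine

/-! ### Equal transitions: only an optimal path matters. -/

section monotone

variable {n K : ℕ} [NeZero n] [NeZero K] {Val : Type} [LinearOrder Val] {d : Fin n → ℕ}
  {h : Fin n → Transition} {val : Fin n → Fin K → Val} {D : AdjLists d} {y : Fin n → Fin K}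
  {f : Fin n → Val}

/-- Two invariants are kept: no computed entry beats the true value, and the computed entries in `S`
are right. At `i ∈ S` the true value then occurs among the arguments, via the successor in `S`, and
is not beaten, so only a failure of the routine at `i` itself can cause an error. Outside `S`
failures are harmless. -/
theorem probOf_sweep_le (hD : IsOrderedDAG D) (hf : IsDPFunction h val D y f) {g : Transition}
    (hg : ∀ i, d i ≠ 0 → h i = g) {k : ℕ} {S : Finset (Fin n)}
    (hS : ∀ i ∈ S, d i ≠ 0 ∧ ∃ e, f (D i e) = f i ∧ (d (D i e) ≠ 0 → D i e ∈ S))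
    (l : List (Fin n)) (hl : l.Pairwise (· > ·)) (hld : ∀ i ∈ l, d i ≠ 0) (t : Fin n → Val)
    (ht : ∀ j, d j ≠ 0 → j ∉ l → ¬ g.Better (f j) (t j)) (htS : ∀ j ∈ S, j ∉ l → t j = f j) :
    (sweep (vertexRoutine h val k) l t).probOf (inputString D y) (fun t' => ∃ j ∈ S, t' j ≠ f j) ≤
      (l.countP (· ∈ S)) * (1 / 10) ^ k := by
  induction l generalizing t with
  | nil =>
    have : ¬ ∃ j ∈ S, t j ≠ f j := by
      rintro ⟨j, hj, hne⟩
      exact hne (htS j hj List.not_mem_nil)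
    simp [sweep, QAlg.probOf, this]
  | cons i l ih =>
    have hi := hld i List.mem_cons_self
    obtain ⟨hil, hl'⟩ := List.pairwise_cons.1 hl
    have hlater : ∀ e, D i e ∉ i :: l := by
      intro e he
      have h1 := hD.sorted i e
      rcases List.mem_cons.1 he with h2 | h2
      · exact h1.ne' h2
      · exact absurd (hil _ h2) (not_lt_of_gt h1)
    have hfi := Transition.isValue_iff.1 (hf.inner i hi)
    rw [hg i hi] at hfi
    have harg : ∀ e, ¬ g.Better (f i) (arguments val t D y i e) := by
      intro e
      refine Transition.not_better_trans (b := f (D i e)) ?_ (hfi.2 e)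
      rw [arguments]
      split_ifs with h0
      · rw [hf.sink _ h0]
        exact irrefl_of g.Better _
      · exact ht _ h0 (hlater e)
    have hval : i ∈ S → (h i).IsValue (arguments val t D y i) (f i) := by
      intro hiS
      rw [hg i hi]
      refine Transition.isValue_iff.2 ⟨?_, harg⟩
      obtain ⟨-, e, he, heS⟩ := hS i hiS
      refine ⟨e, ?_⟩
      rw [arguments]
      split_ifs with h0
      · rw [← hf.sink _ h0, he]
      · rw [htS _ (heS h0) (hlater e), he]
    have hbad : (vertexRoutine h val k i t).probOf (inputString D y)
        (fun v => i ∈ S ∧ v ≠ f i) ≤ if i ∈ S then (1 / 10) ^ k else 0 := by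
      split_ifs with hiS
      · refine ((QAlg.surely_true _ _).probOf_le fun v _ hv hv' => ?_).trans
          (probOf_vertexRoutine_le h val k t D y hi)
        exact hv.2 (hv'.unique (hval hiS))
      · exact ((QAlg.surely_true _ _).probOf_eq_zero fun v _ hv => hiS hv.1).le
    rw [sweep]
    refine ((surely_vertexRoutine h val k t D y hi).probOf_bind_le
      (ε := (l.countP (· ∈ S)) * (1 / 10) ^ k) (Q := fun v => i ∈ S ∧ v ≠ f i)
      (by positivity) ?_).trans ?_
    · rintro v ⟨e, rfl⟩ hv
      refine ih hl' (fun j hj => hld j (List.mem_cons_of_mem _ hj)) _ ?_ ?_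
      · intro j hj hjl
        by_cases hji : j = i
        · subst hji
          rw [Function.update_self]
          exact harg e
        · rw [Function.update_of_ne hji]
          exact ht j hj (by simp [hji, hjl])
      · intro j hj hjl
        by_cases hji : j = i
        · subst hji
          rw [Function.update_self]
          by_contra hne
          exact hv ⟨hj, hne⟩
        · rw [Function.update_of_ne hji]
          exact htS j hj (by simp [hji, hjl])
    · rw [List.countP_cons]
      push_cast
      split_ifs at hbad ⊢ with h1 h2 <;> simp_all
      linarith

omit [NeZero n] [NeZero K] in
-- From `a`, repeatedly move to a neighbour that attains the value, and keep the non-sinks before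
-- the first sink.
theorem exists_optimal_path (hf : IsDPFunction h val D y f) {a : Fin n} {q : ℕ} (hq : 1 ≤ q)
    (ha : IsDepth D a q) : ∃ S : Finset (Fin n), a ∈ S ∧ S.card ≤ q ∧
      ∀ i ∈ S, d i ≠ 0 ∧ ∃ e, f (D i e) = f i ∧ (d (D i e) ≠ 0 → D i e ∈ S) := by
  classical
  have hex : ∀ i, ∃ j, d i ≠ 0 → ∃ e, D i e = j ∧ f j = f i := by
    intro i
    by_cases hi : d i = 0
    · exact ⟨i, fun h => absurd hi h⟩
    · obtain ⟨e, he⟩ := (Transition.isValue_iff.1 (hf.inner i hi)).1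
      exact ⟨D i e, fun _ => ⟨e, rfl, he⟩⟩
  choose next hnext using hex
  set p : ℕ → Fin n := fun j => next^[j] a with hp
  have hps : ∀ j, p (j + 1) = next (p j) := fun j => Function.iterate_succ_apply' next j a
  set S : Finset (Fin n) :=
    ((Finset.range q).filter fun j => ∀ i ≤ j, d (p i) ≠ 0).image p with hS
  refine ⟨S, ?_, ?_, ?_⟩
  · obtain ⟨p', hp0, hp1⟩ := ha.1
    obtain ⟨e, -⟩ := hp1 0 hq
    rw [hp0] at e
    refine Finset.mem_image.2 ⟨0, ?_, rfl⟩
    simp only [Finset.mem_filter, Finset.mem_range]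
    refine ⟨hq, fun i hi => ?_⟩
    rw [Nat.le_zero.1 hi]
    exact (Fin.pos e).ne'
  · exact Finset.card_image_le.trans ((Finset.card_filter_le _ _).trans (Finset.card_range q).le)
  · intro i hi
    obtain ⟨j, hj, rfl⟩ := Finset.mem_image.1 hi
    simp only [Finset.mem_filter, Finset.mem_range] at hj
    obtain ⟨e, he1, he2⟩ := hnext (p j) (hj.2 j le_rfl)
    refine ⟨hj.2 j le_rfl, e, by rw [he1, he2], fun h0 => ?_⟩
    rw [he1, ← hps] at h0 ⊢
    have hall : ∀ i ≤ j + 1, d (p i) ≠ 0 := by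
      intro i hi
      rcases Nat.le_succ_iff.1 hi with hi | rfl
      · exact hj.2 i hi
      · exact h0
    refine Finset.mem_image.2 ⟨j + 1, ?_, rfl⟩
    simp only [Finset.mem_filter, Finset.mem_range]
    refine ⟨?_, hall⟩
    -- `p (j + 1)` is not a sink, so the path extends by one more edge; thus `j + 2 ≤ q`, and the
    -- index `j + 1` is still below `q`.
    have : HasPathFrom D a (j + 2) := by
      refine ⟨p, rfl, fun i hi => ?_⟩
      obtain ⟨e', he', -⟩ := hnext (p i) (hall i (by lia))
      exact ⟨e', by rw [hps, he']⟩
    have := ha.2 this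
    lia

end monotone

/-! ### Mixed transitions: recursive sweeps with verification. -/

section verification

variable {n K : ℕ} [NeZero n] [NeZero K] {Val : Type} [LinearOrder Val] {d : Fin n → ℕ}

/-- Tests for an edge that starts in `l` whether its argument is better than the table entry. -/
def violationProbe (h : Fin n → Transition) (val : Fin n → Fin K → Val) (l : List (Fin n))
    (t : Fin n → Val) :
    Probe ((i : {i // i ∈ l.toFinset}) × Fin (d i)) (Position d) (Fin n × Fin K) Prop where
  fst e := .inl ⟨e.1, e.2⟩
  snd _ u := .inr u.1
  out e u z := (h e.1).Better (t e.1) (if d u.1 = 0 then val u.1 z.2 else t u.1)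

theorem violationProbe_value (h : Fin n → Transition) (val : Fin n → Fin K → Val)
    (l : List (Fin n)) (t : Fin n → Val) (D : AdjLists d) (y : Fin n → Fin K)
    (e : (i : {i // i ∈ l.toFinset}) × Fin (d i)) :
    (violationProbe h val l t).value (inputString D y) e =
      (h e.1).Better (t e.1) (arguments val t D y e.1 e.2) := rfl

open Classical in
/-- Quantum search for an edge that starts in `l` and whose argument is better than the table
entry. -/
noncomputable def findViolation (h : Fin n → Transition) (val : Fin n → Fin K → Val)
    (l : List (Fin n)) (t : Fin n → Val) : DAGAlg d K Prop :=
  if hl : Nonempty ((i : {i // i ∈ l.toFinset}) × Fin (d i)) then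
    (violationProbe h val l t).optimize (· < ·) (Classical.choice hl) 1
  else .ret False

/-- The table `t` has correct entries at the vertices of `l`, relative to their arguments. -/
def Solved (h : Fin n → Transition) (val : Fin n → Fin K → Val) (D : AdjLists d)
    (y : Fin n → Fin K) (l : List (Fin n)) (t : Fin n → Val) : Prop :=
  ∀ i ∈ l, (h i).IsValue (arguments val t D y i) (t i)

/-- The table `t'` arises from `t` by changing the entries in `l`, to values of arguments. -/
def IsRefill (val : Fin n → Fin K → Val) (D : AdjLists d) (y : Fin n → Fin K) (l : List (Fin n))
    (t t' : Fin n → Val) : Prop :=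
  (∀ j, j ∉ l → t' j = t j) ∧ ∀ i ∈ l, t' i ∈ Set.range (arguments val t' D y i)

variable {h : Fin n → Transition} {val : Fin n → Fin K → Val} {D : AdjLists d} {y : Fin n → Fin K}
  {l : List (Fin n)} {t : Fin n → Val}

/-- The search returns the evaluated test of an actual edge, so there are no false alarms and a
correct table is never recomputed. -/
theorem surely_findViolation :
    (findViolation h val l t).Surely (inputString D y) fun b => b → ¬ Solved h val D y l t := by
  unfold findViolation
  split_ifs with hl
  · refine (Probe.surely_optimize _ _ _ _ _).mono ?_
    rintro b ⟨e, rfl⟩ hb hsol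
    rw [violationProbe_value] at hb
    exact (Transition.isValue_iff.1 (hsol e.1 (List.mem_toFinset.1 e.1.2))).2 _ hb
  · simp

theorem probOf_findViolation_le (ht : ∀ i ∈ l, t i ∈ Set.range (arguments val t D y i))
    (hsol : ¬ Solved h val D y l t) :
    (findViolation h val l t).probOf (inputString D y) (fun b => ¬ b) ≤ 1 / 10 := by
  obtain ⟨i, hi, hv⟩ : ∃ i ∈ l, ¬ (h i).IsValue (arguments val t D y i) (t i) := by
    by_contra! hcon
    exact hsol hcon
  obtain ⟨e, he⟩ : ∃ e, (h i).Better (t i) (arguments val t D y i e) := by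
    by_contra! hcon
    exact hv (Transition.isValue_iff.2 ⟨ht i hi, hcon⟩)
  have hl : Nonempty ((i : {i // i ∈ l.toFinset}) × Fin (d i)) :=
    ⟨⟨⟨i, List.mem_toFinset.2 hi⟩, e⟩⟩
  rw [findViolation, dif_pos hl]
  refine ((QAlg.surely_true _ _).probOf_le fun b _ hb => ?_).trans
    ((Probe.probOf_optimize_le _ _ _ _ _).trans_eq (pow_one _))
  -- In the order on `Prop`, `False < True`: optimum finding acts as a search for a true instance,
  -- and a false answer is not optimal when a violated edge exists.
  exact ⟨⟨⟨i, List.mem_toFinset.2 hi⟩, e⟩, lt_iff_le_not_ge.2 ⟨fun h => absurd h hb, fun h => hb (h he)⟩⟩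

theorem expectedTime_findViolation_le (hl : l.Nodup) :
    (findViolation h val l t).expectedTime (inputString D y) ≤ 1922 * √((l.map d).sum : ℕ) := by
  unfold findViolation
  split_ifs with hne
  · refine (Probe.expectedTime_optimize_le _ _ _ _ _).trans ?_
    have hcard : Fintype.card ((i : {i // i ∈ l.toFinset}) × Fin (d i)) = (l.map d).sum := by
      rw [Fintype.card_sigma]
      simp only [Fintype.card_fin]
      rw [Finset.sum_coe_sort l.toFinset d, List.sum_toFinset d hl]
    have h1 : 1 ≤ √((Fintype.card ((i : {i // i ∈ l.toFinset}) × Fin (d i)) : ℕ) : ℝ) :=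
      Real.one_le_sqrt.2 (by exact_mod_cast Fintype.card_pos)
    rw [hcard] at h1 ⊢
    push_cast at h1 ⊢
    linarith
  · simp

omit [NeZero n] [NeZero K] in
-- The first block holds the larger indices and edges increase the index, so refilling the second
-- block leaves both the entries and the arguments of the first untouched.
theorem IsRefill.append (hD : ∀ i k, i < D i k) {l₁ l₂ : List (Fin n)}
    (hl : (l₁ ++ l₂).Pairwise (· > ·)) {t t₁ t₂ : Fin n → Val} (h₁ : IsRefill val D y l₁ t t₁)
    (h₂ : IsRefill val D y l₂ t₁ t₂) :
    IsRefill val D y (l₁ ++ l₂) t t₂ ∧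
      (Solved h val D y l₁ t₁ → Solved h val D y l₂ t₂ → Solved h val D y (l₁ ++ l₂) t₂) := by
  have hlt := (List.pairwise_append.1 hl).2.2
  have hnot : ∀ i ∈ l₁, ∀ j, i ≤ j → j ∉ l₂ := fun i hi j hij hj =>
    absurd (hlt i hi j hj) (not_lt_of_ge hij)
  have hsame : ∀ i ∈ l₁, t₂ i = t₁ i ∧ arguments val t₂ D y i = arguments val t₁ D y i :=
    fun i hi => ⟨h₂.1 i (hnot i hi i le_rfl),
      arguments_congr val y hD fun j hj => h₂.1 j (hnot i hi j hj.le)⟩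
  refine ⟨⟨fun j hj => ?_, fun i hi => ?_⟩, fun hs₁ hs₂ i hi => ?_⟩
  · rw [List.mem_append, not_or] at hj
    rw [h₂.1 j hj.2, h₁.1 j hj.1]
  · rcases List.mem_append.1 hi with hi | hi
    · rw [(hsame i hi).1, (hsame i hi).2]
      exact h₁.2 i hi
    · exact h₂.2 i hi
  · rcases List.mem_append.1 hi with hi | hi
    · rw [(hsame i hi).1, (hsame i hi).2]
      exact hs₁ i hi
    · exact hs₂ i hi

open Classical in
/-- Dynamic programming with verification: the vertices of `l` are divided into two blocks, which
are processed recursively one after the other; then the result is verified, and the blocks are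
processed once more if an error is found. -/
noncomputable def verifiedSweep (h : Fin n → Transition) (val : Fin n → Fin K → Val) :
    ℕ → List (Fin n) → (Fin n → Val) → DAGAlg d K (Fin n → Val)
  | 0, l, t => sweep (vertexRoutine h val 2) l t
  | k + 1, l, t =>
    ((verifiedSweep h val k (l.take (2 ^ k)) t).bind
      (verifiedSweep h val k (l.drop (2 ^ k)))).bind fun t' =>
      (findViolation h val l t').bind fun b =>
        if b then (verifiedSweep h val k (l.take (2 ^ k)) t).bind
          (verifiedSweep h val k (l.drop (2 ^ k)))
        else .ret t'

/-- What the verified sweep of a block of at most `2 ^ k` vertices guarantees. -/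
structure SweepSpec (h : Fin n → Transition) (val : Fin n → Fin K → Val) (D : AdjLists d)
    (y : Fin n → Fin K) (k : ℕ) (l : List (Fin n)) (t : Fin n → Val)
    (A : DAGAlg d K (Fin n → Val)) : Prop where
  surely : A.Surely (inputString D y) (IsRefill val D y l t)
  error : A.probOf (inputString D y) (fun t' => ¬ Solved h val D y l t') ≤ 1 / 100 / 2 ^ k
  time : A.expectedTime (inputString D y) ≤
    16000 * (1 - (3 / 4) ^ k / 2) * √(2 ^ k * (l.map d).sum : ℕ)

theorem sweepSpec_sweep (hD : IsOrderedDAG D) (hl : l.length ≤ 1) (hld : ∀ i ∈ l, d i ≠ 0)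
    (t : Fin n → Val) : SweepSpec h val D y 0 l t (sweep (vertexRoutine h val 2) l t) := by
  match l, hl with
  | [], _ => exact ⟨by simp [sweep, IsRefill], by simp [sweep, QAlg.probOf, Solved], by simp [sweep]⟩
  | [i], _ =>
    have hi := hld i List.mem_cons_self
    have harg : ∀ v, arguments val (Function.update t i v) D y i = arguments val t D y i :=
      fun v => arguments_congr val y hD.sorted fun j hj => Function.update_of_ne hj.ne' _ _
    refine ⟨?_, ?_, ?_⟩
    · refine (surely_vertexRoutine h val 2 t D y hi).bind fun v hv => ?_
      refine ⟨fun j hj => Function.update_of_ne (by simpa using hj) _ _, fun j hj => ?_⟩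
      rw [List.mem_singleton.1 hj, Function.update_self, harg]
      exact hv
    · have hsol : ∀ v, Solved h val D y [i] (Function.update t i v) ↔
          (h i).IsValue (arguments val t D y i) v := by
        simp [Solved, harg]
      have hprob : (sweep (vertexRoutine h val 2) [i] t).probOf (inputString D y)
          (fun t' => ¬ Solved h val D y [i] t') = (vertexRoutine h val 2 i t).probOf
            (inputString D y) fun v => ¬ Solved h val D y [i] (Function.update t i v) := by
        rw [sweep, QAlg.probOf, QAlg.expect_bind]
        rfl
      rw [hprob]
      simp only [hsol]
      exact (probOf_vertexRoutine_le h val 2 t D y hi).trans (by norm_num)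
    · refine (expectedTime_sweep_le _ _ (fun i => 1922 * 2 * √(d i : ℝ)) _ ?_ t).trans ?_
      · intro j hj t
        exact_mod_cast expectedTime_vertexRoutine_le h val 2 t D y (hld j hj) (by norm_num)
      · simp only [List.map_cons, List.map_nil, List.sum_singleton, pow_zero, one_mul]
        have := Real.sqrt_nonneg (d i : ℝ)
        linarith

/-- Makes the time budgets of two half blocks add up to the budget of the whole, however unevenly
the edges are divided. -/
theorem sqrt_mul_add_le {P a b : ℝ} (hP : 0 ≤ P) (ha : 0 ≤ a) (hb : 0 ≤ b) :
    √(P * a) + √(P * b) ≤ √(2 * P * (a + b)) := by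
  refine Real.le_sqrt_of_sq_le ?_
  have h1 := Real.sq_sqrt (mul_nonneg hP ha)
  have h2 := Real.sq_sqrt (mul_nonneg hP hb)
  have h3 := sq_nonneg (√(P * a) - √(P * b))
  nlinarith

/-- Since `3 / 4 * √2 ≥ 1`, verification at level `k` is a geometrically small share of the budget
at that level. -/
theorem sqrt_le_pow_mul_sqrt (k : ℕ) {a : ℝ} (ha : 0 ≤ a) : √a ≤ (3 / 4) ^ k * √(2 ^ k * a) := by
  induction k with
  | zero => simp
  | succ k ih =>
    refine ih.trans ?_
    rw [pow_succ, pow_succ, mul_assoc]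
    refine mul_le_mul_of_nonneg_left ?_ (by positivity)
    refine Real.sqrt_le_iff.2 ⟨by positivity, ?_⟩
    rw [mul_pow, Real.sq_sqrt (by positivity)]
    have : 0 ≤ 2 ^ k * a := by positivity
    linarith

theorem sweepSpec_bind (hD : IsOrderedDAG D) {k : ℕ} {l₁ l₂ : List (Fin n)}
    (hl : (l₁ ++ l₂).Pairwise (· > ·)) {A : DAGAlg d K (Fin n → Val)}
    {B : (Fin n → Val) → DAGAlg d K (Fin n → Val)} (hA : SweepSpec h val D y k l₁ t A)
    (hB : ∀ t, SweepSpec h val D y k l₂ t (B t)) :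
    (A.bind B).Surely (inputString D y) (IsRefill val D y (l₁ ++ l₂) t) ∧
      (A.bind B).probOf (inputString D y) (fun t' => ¬ Solved h val D y (l₁ ++ l₂) t') ≤
        1 / 50 / 2 ^ k ∧
      (A.bind B).expectedTime (inputString D y) ≤
        16000 * (1 - (3 / 4) ^ k / 2) * √(2 ^ (k + 1) * ((l₁ ++ l₂).map d).sum : ℕ) := by
  refine ⟨?_, ?_, ?_⟩
  · exact hA.surely.bind fun t₁ h₁ => (hB t₁).surely.mono fun t₂ h₂ =>
      (h₁.append (h := h) hD.sorted hl h₂).1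
  · refine (hA.surely.probOf_bind_le (Q := fun t' => ¬ Solved h val D y l₁ t')
      (ε := 1 / 100 / 2 ^ k) (by positivity) fun t₁ h₁ hs₁ => ?_).trans ?_
    · refine ((hB t₁).surely.probOf_le fun t₂ h₂ hn hs₂ => hn ?_).trans (hB t₁).error
      exact (h₁.append hD.sorted hl h₂).2 (not_not.1 hs₁) hs₂
    · have := hA.error
      calc _ ≤ 1 / 100 / (2 : ℝ) ^ k + 1 / 100 / 2 ^ k := by gcongr
        _ = _ := by ring
  · refine (QAlg.expectedTime_bind_le _ _ _ fun t => (hB t).time).trans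
      ((add_le_add_left hA.time _).trans ?_)
    rw [← mul_add]
    have h1 : (3 / 4 : ℝ) ^ k ≤ 1 := pow_le_one₀ (by norm_num) (by norm_num)
    refine mul_le_mul_of_nonneg_left ?_ (by linarith)
    rw [List.map_append, List.sum_append]
    generalize (l₁.map d).sum = m₁
    generalize (l₂.map d).sum = m₂
    push_cast
    rw [pow_succ, mul_comm ((2 : ℝ) ^ k) 2]
    exact sqrt_mul_add_le (by positivity) (by positivity) (by positivity)

/-- Failure needs an error in the first run and then a missed detection or an error in the rerun: `1
/ 50 * (1 / 10 + 1 / 50) < 1 / 200`, which beats the halving of the error bound required by the next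
level. -/
theorem sweepSpec_verifiedSweep (hD : IsOrderedDAG D) (k : ℕ) (l : List (Fin n))
    (hl : l.Pairwise (· > ·)) (hlen : l.length ≤ 2 ^ k) (hld : ∀ i ∈ l, d i ≠ 0)
    (t : Fin n → Val) : SweepSpec h val D y k l t (verifiedSweep h val k l t) := by
  classical
  induction k generalizing l t with
  | zero => exact sweepSpec_sweep hD hlen hld t
  | succ k ih =>
    set x := inputString D y with hx
    set A : DAGAlg d K (Fin n → Val) := (verifiedSweep h val k (l.take (2 ^ k)) t).bind
      (verifiedSweep h val k (l.drop (2 ^ k))) with hA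
    have happ : l.take (2 ^ k) ++ l.drop (2 ^ k) = l := List.take_append_drop _ _
    have hspec := sweepSpec_bind hD (h := h) (val := val) (y := y) (k := k) (by rwa [happ])
      (ih (l.take (2 ^ k)) (hl.sublist (List.take_sublist _ _)) (by simp)
        (fun i hi => hld i (List.mem_of_mem_take hi)) t)
      (ih (l.drop (2 ^ k)) (hl.sublist (List.drop_sublist _ _))
        (by rw [List.length_drop]; rw [pow_succ] at hlen; lia)
        (fun i hi => hld i (List.mem_of_mem_drop hi)))
    rw [happ, ← hA] at hspec
    obtain ⟨h1, h2, h3⟩ := hspec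
    have hk : (0 : ℝ) < 1 / 2 ^ k := by positivity
    have hk1 : (1 : ℝ) / 2 ^ k ≤ (3 / 4) ^ k := by
      rw [← one_div_pow]
      exact pow_le_pow_left₀ (by norm_num) (by norm_num) k
    have hk2 : (1 : ℝ) / 2 ^ k ≤ 1 := by
      rw [← one_div_pow]
      exact pow_le_one₀ (by norm_num) (by norm_num)
    have h2' : A.probOf x (fun t' => ¬ Solved h val D y l t') ≤ 1 / 50 * (1 / 2 ^ k) := by
      refine h2.trans_eq ?_
      ring
    have heq : verifiedSweep h val (k + 1) l t = A.bind fun t' =>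
      (findViolation h val l t').bind fun b => if b then A else .ret t' := rfl
    rw [heq]
    refine ⟨?_, ?_, ?_⟩
    · refine h1.bind fun t' ht' => (QAlg.surely_true _ _).bind fun b _ => ?_
      split_ifs
      · exact h1
      · exact ht'
    · refine (h1.probOf_bind_le_mul (Q := fun t' => ¬ Solved h val D y l t')
        (ε := 1 / 10 + 1 / 50) ?_ ?_).trans ?_
      · intro t' _ hs
        refine ((surely_findViolation (D := D) (y := y)).bind
          (P' := fun t' => Solved h val D y l t') fun b hb => ?_).probOf_eq_zero
          (fun o ho hn => hn ho) |>.le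
        rw [if_neg fun h => hb h (not_not.1 hs)]
        exact not_not.1 hs
      · intro t' ht' hs
        refine ((QAlg.surely_true _ _).probOf_bind_le (Q := fun b => ¬ b) (ε := 1 / 50)
          (by norm_num) fun b _ hb => ?_).trans
          (add_le_add_left (probOf_findViolation_le ht'.2 hs) _)
        rw [if_pos (not_not.1 hb)]
        refine h2'.trans ?_
        linarith
      · have : (1 : ℝ) / 100 / 2 ^ (k + 1) = 1 / 200 * (1 / 2 ^ k) := by
          rw [pow_succ]
          field_simp
          norm_num
        rw [this]
        linarith
    · have hT := A.expectedTime_nonneg x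
      set T := A.expectedTime x with hTdef
      set m : ℝ := (((l.map d).sum : ℕ) : ℝ) with hm
      -- A rerun happens only if the first table is wrong and restarts from the same `t`, so its
      -- cost is the constant `T`, weighted by the error probability.
      have h4 : ∀ t', ((findViolation h val l t').bind fun b =>
          if b then A else .ret t').expectedTime x ≤
          1922 * √m + @ite _ (¬ Solved h val D y l t') (Classical.propDecidable _) 1 0 * T := by
        intro t'
        rw [QAlg.expectedTime_bind]
        refine add_le_add (expectedTime_findViolation_le (hl.imp fun h => h.ne')) ?_
        refine (surely_findViolation.expect_le fun b hb => ?_).trans_eq (QAlg.expect_const _ _ _)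
        by_cases hbt : b
        · rw [if_pos hbt, if_pos (hb hbt), one_mul]
        · rw [if_neg hbt, QAlg.expectedTime_ret]
          split_ifs <;> simp [hT]
      have h5 : (A.bind fun t' => (findViolation h val l t').bind fun b =>
          if b then A else .ret t').expectedTime x ≤ T + (1922 * √m + 1 / 50 * (1 / 2 ^ k) * T) := by
        rw [QAlg.expectedTime_bind]
        refine add_le_add le_rfl ((QAlg.expect_mono _ _ h4).trans ?_)
        rw [QAlg.expect_add, QAlg.expect_const, QAlg.expect_mul_const]
        refine add_le_add le_rfl (mul_le_mul_of_nonneg_right ?_ hT)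
        exact h2'
      refine h5.trans ?_
      have h6 := sqrt_le_pow_mul_sqrt (k + 1) (a := m) (Nat.cast_nonneg _)
      have h7 : √((2 ^ (k + 1) * (l.map d).sum : ℕ) : ℝ) = √(2 ^ (k + 1) * m) := by
        rw [hm, Nat.cast_mul, Nat.cast_pow, Nat.cast_ofNat]
      rw [h7] at h3 ⊢
      set X := √(2 ^ (k + 1) * m)
      have hX : 0 ≤ X := Real.sqrt_nonneg _
      rw [pow_succ] at h6 ⊢
      set u : ℝ := (3 / 4) ^ k with hu
      have hu0 : 0 < u := by positivity
      have hu1 : u ≤ 1 := pow_le_one₀ (by norm_num) (by norm_num)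
      have h8 : (1 / 2 ^ k : ℝ) * T ≤ u * (16000 * X) := by
        refine mul_le_mul hk1 (h3.trans ?_) hT hu0.le
        nlinarith [mul_nonneg hu0.le hX]
      -- The slack between the budgets is `16000 * (1 / 2 - 3 / 8) = 2000` times `u * X`;
      -- verification uses `1922 * 3 / 4` and the rerun `16000 / 50` of it.
      nlinarith [mul_nonneg hu0.le hX]

end verification

/-! ### The list of non-sinks: its size, its cost and the length of paths. -/

section order

variable {n : ℕ} {d : Fin n → ℕ}

/-- The vertices that are not sinks, in decreasing order. -/
def nonSinks (d : Fin n → ℕ) : List (Fin n) :=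
  ((List.finRange n).filter fun i => d i ≠ 0).reverse

theorem mem_nonSinks {i : Fin n} : i ∈ nonSinks d ↔ d i ≠ 0 := by
  simp [nonSinks]

theorem nonSinks_pairwise : (nonSinks d).Pairwise (· > ·) :=
  List.pairwise_reverse.2 ((List.pairwise_lt_finRange n).filter _)

theorem nonSinks_nodup : (nonSinks d).Nodup := nonSinks_pairwise.imp fun h => h.ne'

theorem toFinset_nonSinks : (nonSinks d).toFinset = Finset.univ.filter fun i => d i ≠ 0 := by
  ext i
  simp [mem_nonSinks]

theorem length_nonSinks : (nonSinks d).length = numNonSinks d := by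
  rw [← List.toFinset_card_of_nodup nonSinks_nodup, toFinset_nonSinks, numNonSinks]

theorem sum_map_nonSinks {M : Type*} [AddCommMonoid M] (F : Fin n → M)
    (hF : ∀ i, d i = 0 → F i = 0) : ((nonSinks d).map F).sum = ∑ i, F i := by
  rw [← List.sum_toFinset F nonSinks_nodup, toFinset_nonSinks]
  refine Finset.sum_filter_of_ne fun i _ hi hd => hi (hF i hd)

theorem sum_sqrt_nonSinks_le :
    ((nonSinks d).map fun i => √(d i : ℝ)).sum ≤ √(numNonSinks d * numEdges d) := by
  rw [← List.sum_toFinset _ nonSinks_nodup, toFinset_nonSinks]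
  refine Real.le_sqrt_of_sq_le (sq_sum_le_card_mul_sum_sq.trans ?_)
  rw [numNonSinks]
  refine mul_le_mul_of_nonneg_left ?_ (Nat.cast_nonneg _)
  rw [numEdges, Nat.cast_sum]
  simp only [Real.sq_sqrt (Nat.cast_nonneg _)]
  exact Finset.sum_le_sum_of_subset_of_nonneg (Finset.subset_univ _) fun _ _ _ => Nat.cast_nonneg _

theorem numNonSinks_le : numNonSinks d ≤ n :=
  (Finset.card_le_univ _).trans_eq (Fintype.card_fin n)

/-- The starting points of the edges of a path are distinct non-sinks. This turns error bounds in
`n̂` into bounds in `q`, and `log q` into at most `log n`. -/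
theorem HasPathFrom.le_numNonSinks {D : AdjLists d} (hD : ∀ i k, i < D i k) {a : Fin n} {q : ℕ}
    (h : HasPathFrom D a q) : q ≤ numNonSinks d := by
  obtain ⟨p, -, hp⟩ := h
  have hmono : ∀ j, ∀ i < j, j ≤ q → p i < p j := by
    intro j
    induction j with
    | zero => exact fun i hi => absurd hi (Nat.not_lt_zero i)
    | succ j ih =>
      intro i hi hj
      obtain ⟨e, he⟩ := hp j hj
      have hlt : p j < p (j + 1) := he ▸ hD (p j) e
      rcases Nat.lt_succ_iff_lt_or_eq.1 hi with hij | rfl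
      · exact (ih i hij (by lia)).trans hlt
      · exact hlt
  rw [← Finset.card_range q]
  refine Finset.card_le_card_of_injOn p (fun j hj => ?_) fun i hi j hj hij => ?_
  · obtain ⟨e, -⟩ := hp j (Finset.mem_range.1 hj)
    simpa using (Fin.pos e).ne'
  · have hi' := Finset.mem_range.1 hi
    have hj' := Finset.mem_range.1 hj
    rcases lt_trichotomy i j with hlt | heq | hlt
    · exact absurd hij (hmono j i hlt hj'.le).ne
    · exact heq
    · exact absurd hij (hmono i j hlt hi'.le).ne'

end order

/-! ### Assembling the two algorithms. -/

section final

variable {n K : ℕ} [NeZero n] [NeZero K] {Val : Type} [LinearOrder Val] {d : Fin n → ℕ}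
  {h : Fin n → Transition} {val : Fin n → Fin K → Val} {D : AdjLists d} {y : Fin n → Fin K}
  {f : Fin n → Val} {a : Fin n} {q : ℕ}

omit [NeZero n] [NeZero K] in
-- Induction from the last vertex downwards: local correctness at every non-sink determines the
-- table there.
theorem Solved.eq (hD : IsOrderedDAG D) (hf : IsDPFunction h val D y f) {t : Fin n → Val}
    (ht : Solved h val D y (nonSinks d) t) (i : Fin n) (hi : d i ≠ 0) : t i = f i := by
  induction i using (wellFounded_gt (α := Fin n)).induction with
  | _ i ih =>
    have harg : arguments val t D y i = fun k => f (D i k) := by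
      funext k
      rw [arguments]
      split_ifs with h0
      · exact (hf.sink _ h0).symm
      · exact ih _ (hD.sorted i k) h0
    have hv := ht i (mem_nonSinks.2 hi)
    rw [harg] at hv
    exact hv.unique (hf.inner i hi)

theorem half_le_log (hq : 2 ≤ q) : (1 : ℝ) / 2 ≤ Real.log q := by
  have h1 : Real.log 2 ≤ Real.log q := Real.log_le_log (by norm_num) (by exact_mod_cast hq)
  have := Real.log_two_gt_d9
  linarith

/-- As `1 / 10 ≤ exp (-2)`, the power is at most `1 / q ^ 2`; the factor `q` is the union bound over
the path. -/
theorem tenth_pow_le (hq : 2 ≤ q) : q * (1 / 10 : ℝ) ^ ⌈Real.log q⌉₊ ≤ 1 / q := by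
  have hq0 : (0 : ℝ) < q := by exact_mod_cast (by lia : 0 < q)
  have h1 : (1 / 10 : ℝ) ≤ Real.exp (-2) := by
    have h2 : Real.exp 2 ≤ 10 := by
      have := Real.exp_one_lt_d9
      have h3 : Real.exp 2 = Real.exp 1 * Real.exp 1 := by
        rw [← Real.exp_add]
        norm_num
      have := Real.exp_pos 1
      rw [h3]
      nlinarith
    rw [Real.exp_neg, ← one_div]
    exact one_div_le_one_div_of_le (Real.exp_pos 2) h2
  have h2 : (1 / 10 : ℝ) ^ ⌈Real.log q⌉₊ ≤ 1 / (q * q) := by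
    refine (pow_le_pow_left₀ (by norm_num) h1 _).trans ?_
    rw [← Real.exp_nat_mul]
    have h3 : (1 : ℝ) / (q * q) = Real.exp (-(Real.log q + Real.log q)) := by
      rw [Real.exp_neg, Real.exp_add, Real.exp_log hq0, one_div]
    rw [h3]
    refine Real.exp_le_exp.2 ?_
    have := Nat.le_ceil (Real.log q)
    linarith
  calc _ ≤ q * (1 / (q * q : ℝ)) := mul_le_mul_of_nonneg_left h2 hq0.le
    _ = 1 / q := by field_simp

omit [NeZero n] [LinearOrder Val] in
theorem QAlg.one_sub_prob_entry_le {ι α : Type} [Fintype ι] [Fintype α] [DecidableEq ι]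
    [DecidableEq α] [AddCommGroup α] (A : QAlg ι α (Fin n → Val)) {x : ι → α} {v : Val}
    {P : (Fin n → Val) → Prop} (hP : ∀ t, t a ≠ v → P t) :
    1 - (A.bind fun t => .ret (t a)).prob x v ≤ A.probOf x P := by
  rw [one_sub_prob, probOf, expect_bind]
  exact (A.surely_true x).probOf_le fun t _ => hP t

theorem one_sub_prob_sweep_le (hq : 2 ≤ q) (hD : IsOrderedDAG D) (ha : IsDepth D a q)
    (hf : IsDPFunction h val D y f) {g : Transition} (hg : ∀ i, d i ≠ 0 → h i = g)
    (t : Fin n → Val) :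
    1 - ((sweep (vertexRoutine h val ⌈Real.log q⌉₊) (nonSinks d) t).bind
      fun t => .ret (t a)).prob (inputString D y) (f a) ≤ 1 / q := by
  obtain ⟨S, haS, hcard, hS⟩ := exists_optimal_path hf (by lia) ha
  refine (QAlg.one_sub_prob_entry_le _ (P := fun t' => ∃ j ∈ S, t' j ≠ f j)
    fun t' ht' => ⟨a, haS, ht'⟩).trans ?_
  refine (probOf_sweep_le hD hf hg hS _ nonSinks_pairwise (fun i hi => mem_nonSinks.1 hi) t
    (fun j hj hj' => absurd (mem_nonSinks.2 hj) hj')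
    (fun j hj hj' => absurd (mem_nonSinks.2 (hS j hj).1) hj')).trans ?_
  refine le_trans ?_ (tenth_pow_le hq)
  refine mul_le_mul_of_nonneg_right (Nat.cast_le.2 (le_trans ?_ hcard)) (by positivity)
  rw [List.countP_eq_length_filter, ← List.toFinset_card_of_nodup (nonSinks_nodup.filter _)]
  refine Finset.card_le_card fun i hi => ?_
  simpa using (List.mem_filter.1 (List.mem_toFinset.1 hi)).2

theorem expectedTime_sweep_nonSinks_le (hq : 2 ≤ q) (t : Fin n → Val) :
    (sweep (vertexRoutine h val ⌈Real.log q⌉₊) (nonSinks d) t).expectedTime (inputString D y) ≤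
      5766 * (√(numNonSinks d * numEdges d) * Real.log q) := by
  have hlog := half_le_log hq
  have hk : 1 ≤ ⌈Real.log q⌉₊ := Nat.one_le_ceil_iff.2 (by linarith)
  have hk' := Nat.ceil_lt_add_one (show 0 ≤ Real.log q by linarith)
  refine (expectedTime_sweep_le _ _ (fun i => 1922 * (⌈Real.log q⌉₊ : ℝ) * √(d i : ℝ)) _
    (fun i hi t => expectedTime_vertexRoutine_le h val _ t D y (mem_nonSinks.1 hi) hk) t).trans ?_
  rw [List.sum_map_mul_left]
  have h1 := sum_sqrt_nonSinks_le (d := d)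
  have h2 := Real.sqrt_nonneg ((numNonSinks d : ℝ) * numEdges d)
  refine (mul_le_mul_of_nonneg_left h1 (by positivity)).trans ?_
  calc _ ≤ 1922 * (3 * Real.log q) * √(numNonSinks d * numEdges d) := by
        gcongr
        linarith
    _ = _ := by ring

/-- The recursion depth makes `2 ^ k` lie between `n̂` and `2 * n̂`. The sweep itself needs no
logarithm; `log q ≥ 1 / 2` only fits it to the common bound, whence `64000 = 2 * 2 * 16000`. -/
theorem verifiedSweep_nonSinks (hq : 2 ≤ q) (hD : IsOrderedDAG D) (ha : IsDepth D a q)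
    (hf : IsDPFunction h val D y f) (t : Fin n → Val) :
    1 - ((verifiedSweep h val (Nat.clog 2 (numNonSinks d)) (nonSinks d) t).bind
      fun t => .ret (t a)).prob (inputString D y) (f a) ≤ 1 / q ∧
    (verifiedSweep h val (Nat.clog 2 (numNonSinks d)) (nonSinks d) t).expectedTime
      (inputString D y) ≤ 64000 * (√(numNonSinks d * numEdges d) * Real.log q) := by
  have hqn : q ≤ numNonSinks d := HasPathFrom.le_numNonSinks hD.sorted ha.1
  set N := numNonSinks d with hN
  have hlow : N ≤ 2 ^ Nat.clog 2 N := Nat.le_pow_clog (by norm_num) N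
  have hhigh : 2 ^ Nat.clog 2 N ≤ 2 * N := by
    have h1 := Nat.pow_pred_clog_lt_self (b := 2) (by norm_num) (x := N) (by lia)
    have h2 : Nat.clog 2 N ≠ 0 := (Nat.clog_pos (by norm_num) (by lia)).ne'
    rw [← Nat.succ_pred_eq_of_ne_zero h2, pow_succ]
    lia
  have hlog := half_le_log hq
  have hspec := sweepSpec_verifiedSweep (h := h) (val := val) (y := y) hD (Nat.clog 2 N)
    (nonSinks d) nonSinks_pairwise (length_nonSinks.trans_le hlow)
    (fun i hi => mem_nonSinks.1 hi) t
  have hda : d a ≠ 0 := by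
    obtain ⟨p, hp0, hp⟩ := ha.1
    obtain ⟨e, -⟩ := hp 0 (by lia)
    rw [hp0] at e
    exact (Fin.pos e).ne'
  constructor
  · refine (QAlg.one_sub_prob_entry_le _ (P := fun t' => ¬ Solved h val D y (nonSinks d) t')
      fun t' ht' hs => ht' (hs.eq hD hf a hda)).trans (hspec.error.trans ?_)
    have hq0 : (0 : ℝ) < q := by exact_mod_cast (by lia : 0 < q)
    rw [div_div]
    refine one_div_le_one_div_of_le hq0 ?_
    have : (q : ℝ) ≤ 2 ^ Nat.clog 2 N := by exact_mod_cast hqn.trans hlow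
    linarith
  · refine hspec.time.trans ?_
    rw [sum_map_nonSinks d fun i hi => hi]
    change 16000 * (1 - (3 / 4) ^ Nat.clog 2 N / 2) * √(2 ^ Nat.clog 2 N * numEdges d : ℕ) ≤ _
    have h1 : √((2 ^ Nat.clog 2 N * numEdges d : ℕ) : ℝ) ≤ 2 * √(N * numEdges d) := by
      refine Real.sqrt_le_iff.2 ⟨by positivity, ?_⟩
      rw [mul_pow, Real.sq_sqrt (by positivity)]
      have : 2 ^ Nat.clog 2 N * numEdges d ≤ 2 * N * numEdges d := Nat.mul_le_mul_right _ hhigh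
      have h2 : ((2 ^ Nat.clog 2 N * numEdges d : ℕ) : ℝ) ≤ 2 * N * numEdges d := by
        exact_mod_cast this
      have h3 : (0 : ℝ) ≤ N * numEdges d := by positivity
      linarith
    have h2 : (0 : ℝ) ≤ (3 / 4) ^ Nat.clog 2 N := by positivity
    have h3 := Real.sqrt_nonneg ((N : ℝ) * numEdges d)
    calc _ ≤ 16000 * 1 * (2 * √(N * numEdges d)) := by
          refine mul_le_mul ?_ h1 (Real.sqrt_nonneg _) (by norm_num)
          linarith
      _ ≤ _ := by nlinarith

end final

theorem lemma6 :
    ∃ C : ℝ, 0 < C ∧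
      ∀ (n K : ℕ) [NeZero n] [NeZero K] (Val : Type) [LinearOrder Val]
        (d : Fin n → ℕ) (h : Fin n → Transition) (val : Fin n → Fin K → Val)
        (a : Fin n) (q : ℕ), 2 ≤ q →
        ∃ A : DAGAlg d K Val,
          ((∃ g : Transition, ∀ i, d i ≠ 0 → h i = g) → IsDynamicProgram h val a A) ∧
          ∀ (D : AdjLists d) (y : Fin n → Fin K) (f : Fin n → Val),
            IsOrderedDAG D → IsDepth D a q → IsDPFunction h val D y f →
              1 - A.prob (inputString D y) (f a) ≤ C / q ∧
              A.expectedTime (inputString D y) ≤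
                C * (Real.sqrt (numNonSinks d * numEdges d) * Real.log q) ∧
              A.expectedTime (inputString D y) ≤
                C * (Real.sqrt (n * numEdges d) * Real.log n) := by
  refine ⟨64000, by norm_num, fun n K _ _ Val _ d h val a q hq => ?_⟩
  have hlog := half_le_log hq
  suffices hmain : ∃ B : DAGAlg d K (Fin n → Val),
      ((∃ g : Transition, ∀ i, d i ≠ 0 → h i = g) →
        IsDynamicProgram h val a (B.bind fun t => .ret (t a))) ∧
      ∀ (D : AdjLists d) (y : Fin n → Fin K) (f : Fin n → Val),
        IsOrderedDAG D → IsDepth D a q → IsDPFunction h val D y f →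
          1 - (B.bind fun t => .ret (t a)).prob (inputString D y) (f a) ≤ 1 / q ∧
          B.expectedTime (inputString D y) ≤
            64000 * (Real.sqrt (numNonSinks d * numEdges d) * Real.log q) by
    obtain ⟨B, hdp, hB⟩ := hmain
    refine ⟨B.bind fun t => .ret (t a), hdp, fun D y f hD ha hf => ?_⟩
    obtain ⟨h1, h2⟩ := hB D y f hD ha hf
    have hqn : q ≤ numNonSinks d := HasPathFrom.le_numNonSinks hD.sorted ha.1
    have htime : (B.bind fun t => .ret (t a)).expectedTime (inputString D y) =
        B.expectedTime (inputString D y) := by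
      simp only [QAlg.expectedTime_bind, QAlg.expectedTime_ret, QAlg.expect_const, add_zero]
    rw [htime]
    refine ⟨h1.trans (div_le_div_of_nonneg_right (by norm_num) (Nat.cast_nonneg q)), h2,
      h2.trans ?_⟩
    have hNn : (numNonSinks d : ℝ) ≤ n := by exact_mod_cast numNonSinks_le
    have hqn' : (q : ℝ) ≤ n := by exact_mod_cast hqn.trans numNonSinks_le
    have hq0 : (0 : ℝ) < q := by exact_mod_cast (by lia : 0 < q)
    have := Real.log_le_log hq0 hqn'
    gcongr
  by_cases hg : ∃ g : Transition, ∀ i, d i ≠ 0 → h i = g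
  · have hk : 1 ≤ ⌈Real.log q⌉₊ := Nat.one_le_ceil_iff.2 (by linarith)
    -- The initial table is arbitrary: on an ordered DAG each non-sink entry is overwritten before
    -- it is used, and sinks are read from the input.
    refine ⟨sweep (vertexRoutine h val ⌈Real.log q⌉₊) (nonSinks d) fun _ => val 0 0, fun _ =>
      ⟨vertexRoutine h val ⌈Real.log q⌉₊, fun _ => val 0 0,
        fun i hi => isVertexRoutine_vertexRoutine h val _ hi hk, rfl⟩,
      fun D y f hD ha hf => ⟨?_, ?_⟩⟩
    · obtain ⟨g, hg⟩ := hg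
      exact one_sub_prob_sweep_le hq hD ha hf hg _
    · refine (expectedTime_sweep_nonSinks_le hq _).trans ?_
      have := Real.sqrt_nonneg ((numNonSinks d : ℝ) * numEdges d)
      gcongr
      norm_num
  · exact ⟨verifiedSweep h val (Nat.clog 2 (numNonSinks d)) (nonSinks d) fun _ => val 0 0,
      fun hg' => absurd hg' hg, fun D y f hD ha hf => verifiedSweep_nonSinks hq hD ha hf _⟩
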